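/- Let $n\ge 2$ and let $w\in\mathfrak S_n$ be fully supported, i.e. $\{w(1),\dots,w(r)\}\ne\{1,\dots,r\}$ for all $1\le r<n$. Let $u_1,\dots,u_n$ be unit vectors in the plane whose angles satisfy $\pi<\theta_1<\dots<\theta_n<2\pi$. Elnitsky's polygon $X(w)$ is the region enclosed by the two paths which start at a common top vertex and have successive edge vectors $u_1,\dots,u_n$ (the leftside boundary) and $u_{w(1)},\dots,u_{w(n)}$ (the rightside boundary); they end at a common bottom vertex, and a side parallel to $u_k$ is labeled $k$. A rhombic tiling of $X(w)$ is a finite set of rhombi (tiles) with pairwise disjoint interiors whose union is $X(w)$, each with its edges equal to translates of sides of $X(w)$ with two distinct labels; these are the labels of the tile. A forced bottom-perimeter tile for $w$ is a tile that belongs to every rhombic tiling of $X(w)$ and has as edges the two sides of $X(w)$ meeting at the bottom vertex. Then the following are equivalent: (a) there is a forced bottom-perimeter tile for $w$; (b) the values $w(n)$ and $n$ do not appear together in a $321$-pattern of $w$, i.e. there are no positions $i<j<k$ with $w(i)>w(j)>w(k)$ and $w(n),n\in\{w(i),w(j),w(k)\}$; (c) reading $w$ from right to left, the first right-to-left maximum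 after $w(n)$ is $n$, where $w(i)$ is a right-to-left maximum if $w(j)<w(i)$ for all $j>i$. Moreover, any forced bottom-perimeter tile for $w$ has labels $\{n,w(n)\}$. -/

import Mathlib

/-! Elnitsky polygons of permutations, their rhombic tilings, and forced bottom-perimeter tiles.
The plane is `ℂ`. Labels and positions are elements of `Fin n`, so that the label (or position) `k`
of the `1`-based convention is the element of `Fin n` with value `k - 1`. -/

namespace Elnitsky

/-- The angles of the side directions, travelling from the top vertex to the bottom vertex: strictly
increasing and in the open interval `(π, 2π)`, so that all sides point downwards and the path with
sides `1, …, n` turns counterclockwise by less than `π`, i.e. is half of a convex `2n`-gon. -/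
def IsDirectionSystem {n : ℕ} (θ : Fin n → ℝ) : Prop :=
  StrictMono θ ∧ ∀ k, θ k ∈ Set.Ioo Real.pi (2 * Real.pi)

/-- The unit vector along the sides labelled `k`. -/
noncomputable def dir {n : ℕ} (θ : Fin n → ℝ) (k : Fin n) : ℂ :=
  Complex.exp ((θ k : ℂ) * Complex.I)

/-- The vertex reached from the top vertex `0` after the first `k` sides of the path whose sides
are labelled `w(1), w(2), …, w(n)` from top to bottom. -/
noncomputable def pathVertex {n : ℕ} (θ : Fin n → ℝ) (w : Equiv.Perm (Fin n)) (k : ℕ) : ℂ :=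
  ∑ i : Fin n with i.val < k, dir θ (w i)

/-- The side in position `k` (labelled `w(k)`) of that path. -/
noncomputable def pathSide {n : ℕ} (θ : Fin n → ℝ) (w : Equiv.Perm (Fin n)) (k : Fin n) : Set ℂ :=
  segment ℝ (pathVertex θ w k.val) (pathVertex θ w (k.val + 1))

/-- The sides of the leftside boundary, labelled `1, …, n` from top to bottom. -/
noncomputable def leftSide {n : ℕ} (θ : Fin n → ℝ) (k : Fin n) : Set ℂ :=
  pathSide θ 1 k

/-- The sides of the rightside boundary, labelled `w(1), …, w(n)` from top to bottom. -/
noncomputable def rightSide {n : ℕ} (θ : Fin n → ℝ) (w : Equiv.Perm (Fin n)) (k : Fin n) : Set ℂ :=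
  pathSide θ w k

/-- Elnitsky's polygon `X(w)`, as a closed region. Both boundary paths descend strictly from the
common top vertex to the common bottom vertex, so the region that they enclose consists of
the points lying, on their horizontal line, between the leftside and the rightside boundary. -/
def polygon {n : ℕ} (θ : Fin n → ℝ) (w : Equiv.Perm (Fin n)) : Set ℂ :=
  {z | ∃ p ∈ ⋃ k, leftSide θ k, ∃ q ∈ ⋃ k, rightSide θ w k,
    p.im = z.im ∧ q.im = z.im ∧ p.re ≤ z.re ∧ z.re ≤ q.re}

/-- A rhombus whose sides are translates of the sides of the polygon with two distinct labels
`lo < hi`; it is determined by these labels and by its highest vertex `top`. -/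
structure Tile (n : ℕ) where
  top : ℂ
  lo : Fin n
  hi : Fin n
  lo_lt_hi : lo < hi

/-- The labels of a tile. -/
def Tile.labels {n : ℕ} (t : Tile n) : Finset (Fin n) := {t.lo, t.hi}

/-- The closed rhombus occupied by a tile. -/
def Tile.region {n : ℕ} (θ : Fin n → ℝ) (t : Tile n) : Set ℂ :=
  {z | ∃ a ∈ Set.Icc (0 : ℝ) 1, ∃ b ∈ Set.Icc (0 : ℝ) 1,
    z = t.top + (a : ℂ) * dir θ t.lo + (b : ℂ) * dir θ t.hi}

/-- The four edges of a tile: upper left, upper right, lower left, lower right. -/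
def Tile.edges {n : ℕ} (θ : Fin n → ℝ) (t : Tile n) : Set (Set ℂ) :=
  {segment ℝ t.top (t.top + dir θ t.lo),
   segment ℝ t.top (t.top + dir θ t.hi),
   segment ℝ (t.top + dir θ t.lo) (t.top + dir θ t.lo + dir θ t.hi),
   segment ℝ (t.top + dir θ t.hi) (t.top + dir θ t.lo + dir θ t.hi)}

/-- `T` is a rhombic tiling of `X(w)`: the tiles cover exactly the polygon, and distinct tiles have
disjoint interiors. -/
def IsRhombicTiling {n : ℕ} (θ : Fin n → ℝ) (w : Equiv.Perm (Fin n)) (T : Finset (Tile n)) : Prop :=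
  (⋃ t ∈ T, t.region θ) = polygon θ w ∧
    ∀ s ∈ T, ∀ t ∈ T, s ≠ t → Disjoint (interior (s.region θ)) (interior (t.region θ))

/-- The tile has among its edges both sides of the polygon that meet at the bottom vertex. -/
def IsBottomPerimeterTile {m : ℕ} (θ : Fin (m + 1) → ℝ) (w : Equiv.Perm (Fin (m + 1)))
    (t : Tile (m + 1)) : Prop :=
  leftSide θ (Fin.last m) ∈ t.edges θ ∧ rightSide θ w (Fin.last m) ∈ t.edges θ

/-- The tile `t` appears as a bottom-perimeter tile in every rhombic tiling of `X(w)`. -/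
def IsForcedBottomPerimeterTile {m : ℕ} (θ : Fin (m + 1) → ℝ) (w : Equiv.Perm (Fin (m + 1)))
    (t : Tile (m + 1)) : Prop :=
  ∀ T : Finset (Tile (m + 1)), IsRhombicTiling θ w T → t ∈ T ∧ IsBottomPerimeterTile θ w t

/-- `{w(1), …, w(r)} ≠ {1, …, r}` for all `1 ≤ r < n`. -/
def FullySupported {n : ℕ} (w : Equiv.Perm (Fin n)) : Prop :=
  ∀ r : ℕ, 1 ≤ r → r < n → w '' {i | i.val < r} ≠ {i | i.val < r}

/-- The values `a` and `b` appear together in some `321`-pattern of `w`. -/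
def TogetherIn321 {n : ℕ} (w : Equiv.Perm (Fin n)) (a b : Fin n) : Prop :=
  ∃ i j k : Fin n, i < j ∧ j < k ∧ w k < w j ∧ w j < w i ∧
    a ∈ ({w i, w j, w k} : Set (Fin n)) ∧ b ∈ ({w i, w j, w k} : Set (Fin n))

/-- The value in position `i` is a right-to-left maximum of `w`. -/
def IsRLMax {n : ℕ} (w : Equiv.Perm (Fin n)) (i : Fin n) : Prop :=
  ∀ j, i < j → w j < w i

/-- Reading `w` from right to left, the value `v` is the first right-to-left maximum met after
the value `w(n)`; that is, the position of `v` is the rightmost position before the last one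
that holds a right-to-left maximum. -/
def IsFirstRLMaxAfterLast {m : ℕ} (w : Equiv.Perm (Fin (m + 1))) (v : Fin (m + 1)) : Prop :=
  IsGreatest {i | i < Fin.last m ∧ IsRLMax w i} (w.symm v)

end Elnitsky

/-! The proof follows Elnitsky's correspondence between tilings and sequences of descents. If `w k >
w (k + 1)`, exchanging these entries removes one rhombus from the right of `X(w)`
(`polygon_eq_union`). Conversely, whenever `w ≠ 1`, every tiling contains a rhombus flush with two
consecutive right sides (`IsTilingOffLeft.exists_swapTile_mem`), and erasing it leaves a tiling of
the smaller polygon. The smaller permutations need not be fully supported, and their polygons may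
collapse onto the left boundary. The induction therefore uses `IsTilingOffLeft`, which does not ask
for that boundary to be covered; closedness restores the coverage for a fully supported `w`
(`IsTilingOffLeft.isRhombicTiling`).

All conditions reduce to one: no entry strictly between the value `n` and the last position exceeds
`w(n)`. If it holds, it persists while tiles not involving the last entry are peeled off. When the
last entry is finally exchanged, its left neighbour is larger, so it can only be `n`, and the peeled
tile is the bottom tile (`IsTilingOffLeft.exists_bottom`).

If it fails, the nearest entry to the left of `w(n)` that is larger than `w(n)` is not `n`. It can
be moved next to `w(n)` through descents, which yields a tiling with another bottom tile
(`exists_isTilingOffLeft_bottom`). A forced tile would share the bottom right side with that tile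
and hence equal it. -/

namespace Elnitsky

open Set Filter Topology

/-! ### Side vectors and their cross products. -/

section Directions

variable {n : ℕ} {θ : Fin n → ℝ}

lemma dir_re (k : Fin n) : (dir θ k).re = Real.cos (θ k) := Complex.exp_ofReal_mul_I_re _

lemma dir_im (k : Fin n) : (dir θ k).im = Real.sin (θ k) := Complex.exp_ofReal_mul_I_im _

lemma dir_im_neg (hθ : IsDirectionSystem θ) (k : Fin n) : (dir θ k).im < 0 := by
  rw [dir_im, ← Real.sin_sub_two_pi]
  have h := hθ.2 k
  exact Real.sin_neg_of_neg_of_neg_pi_lt (by linarith [h.2]) (by linarith [h.1])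

lemma cross_pos (hθ : IsDirectionSystem θ) {i j : Fin n} (h : i < j) :
    0 < (dir θ i).re * (dir θ j).im - (dir θ i).im * (dir θ j).re := by
  have e : (dir θ i).re * (dir θ j).im - (dir θ i).im * (dir θ j).re = Real.sin (θ j - θ i) := by
    rw [dir_re, dir_re, dir_im, dir_im, Real.sin_sub]; ring
  rw [e]
  have := hθ.1 h
  exact Real.sin_pos_of_pos_of_lt_pi (by linarith) (by linarith [(hθ.2 i).1, (hθ.2 j).2])

/-- Two sides with distinct labels are not parallel. -/
lemma dir_combination_eq_zero (hθ : IsDirectionSystem θ) {i j : Fin n} (h : i ≠ j) {a b : ℝ}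
    (e : (a : ℂ) * dir θ i + (b : ℂ) * dir θ j = 0) : a = 0 ∧ b = 0 := by
  have h1 : a * (dir θ i).re + b * (dir θ j).re = 0 := by simpa using congrArg Complex.re e
  have h2 : a * (dir θ i).im + b * (dir θ j).im = 0 := by simpa using congrArg Complex.im e
  have hD : (dir θ i).re * (dir θ j).im - (dir θ i).im * (dir θ j).re ≠ 0 := by
    rcases lt_or_gt_of_ne h with h | h
    · exact (cross_pos hθ h).ne'
    · have := cross_pos hθ h
      intro h0
      linarith
  constructor
  · refine (mul_eq_zero.1 ?_).resolve_right hD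
    linear_combination (dir θ j).im * h1 - (dir θ j).re * h2
  · refine (mul_eq_zero.1 ?_).resolve_right hD
    linear_combination (dir θ i).re * h2 - (dir θ i).im * h1

lemma eq_of_mul_dir_eq (hθ : IsDirectionSystem θ) {i j : Fin n} {a b : ℝ} (ha : a ≠ 0)
    (e : (a : ℂ) * dir θ i = (b : ℂ) * dir θ j) : i = j := by
  by_contra h
  refine ha (dir_combination_eq_zero hθ h (a := a) (b := -b) ?_).1
  rw [e]; push_cast; ring

lemma dir_ne_zero (hθ : IsDirectionSystem θ) (k : Fin n) : dir θ k ≠ 0 := fun h => by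
  have := dir_im_neg hθ k
  rw [h] at this
  simp at this

lemma dir_injective (hθ : IsDirectionSystem θ) : Function.Injective (dir θ) := fun i j h =>
  eq_of_mul_dir_eq hθ (a := 1) (b := 1) one_ne_zero (by rw [h])

/-- The horizontal unit vector in terms of two side vectors. -/
lemma exists_one_eq (hθ : IsDirectionSystem θ) {i j : Fin n} (h : i < j) :
    ∃ α > (0 : ℝ), ∃ β > (0 : ℝ), (1 : ℂ) = (α : ℂ) * dir θ j - (β : ℂ) * dir θ i := by
  have hD := cross_pos hθ h
  set D := (dir θ i).re * (dir θ j).im - (dir θ i).im * (dir θ j).re with hDdef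
  refine ⟨-(dir θ i).im / D, div_pos (neg_pos.2 (dir_im_neg hθ i)) hD,
    -(dir θ j).im / D, div_pos (neg_pos.2 (dir_im_neg hθ j)) hD, ?_⟩
  apply Complex.ext
  · simp only [Complex.one_re, Complex.sub_re, Complex.re_ofReal_mul]
    field_simp
    rw [hDdef]; ring
  · simp only [Complex.one_im, Complex.sub_im, Complex.im_ofReal_mul]
    field_simp
    ring

end Directions

/-! ### Boundary paths, the zonotope inequality, and the polygon as a set. -/

section Paths

variable {m : ℕ} {θ : Fin (m + 1) → ℝ}

/-- The boundary path whose sides are labelled `w(1), …, w(n)` from top to bottom. -/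
def path (θ : Fin (m + 1) → ℝ) (w : Equiv.Perm (Fin (m + 1))) : Set ℂ := ⋃ k, pathSide θ w k

/-- How much of the side in position `i` lies above the point at arc length `τ` of a path. -/
noncomputable def ramp (τ : ℝ) (i : Fin (m + 1)) : ℝ := max 0 (min 1 (τ - i))

/-- The point at arc length `τ` of a path. -/
noncomputable def pathPoint (θ : Fin (m + 1) → ℝ) (w : Equiv.Perm (Fin (m + 1))) (τ : ℝ) : ℂ :=
  ∑ i, (ramp τ i : ℂ) * dir θ (w i)

lemma ramp_nonneg (τ : ℝ) (i : Fin (m + 1)) : 0 ≤ ramp τ i := le_max_left _ _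

lemma ramp_le_one (τ : ℝ) (i : Fin (m + 1)) : ramp τ i ≤ 1 :=
  max_le zero_le_one (min_le_left _ _)

lemma ramp_mono (i : Fin (m + 1)) {τ τ' : ℝ} (h : τ ≤ τ') : ramp τ i ≤ ramp τ' i :=
  max_le_max le_rfl (min_le_min le_rfl (by linarith))

lemma ramp_add (k : Fin (m + 1)) {s : ℝ} (hs : s ∈ Icc (0 : ℝ) 1) (i : Fin (m + 1)) :
    ramp ((k : ℕ) + s) i = if i < k then 1 else if i = k then s else 0 := by
  unfold ramp
  obtain ⟨h0, h1⟩ := hs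
  split_ifs with h h'
  · have : ((i : ℕ) : ℝ) + 1 ≤ (k : ℕ) := by exact_mod_cast h
    rw [min_eq_left (by linarith), max_eq_right zero_le_one]
  · subst h'
    rw [add_sub_cancel_left, min_eq_right h1, max_eq_right h0]
  · have : ((k : ℕ) : ℝ) + 1 ≤ (i : ℕ) := by
      exact_mod_cast lt_of_le_of_ne (not_lt.1 h) (Ne.symm h')
    exact max_eq_left ((min_le_right _ _).trans (by linarith))

lemma exists_eq_add {τ : ℝ} (h : τ ∈ Icc (0 : ℝ) (m + 1)) :
    ∃ k : Fin (m + 1), ∃ s ∈ Icc (0 : ℝ) 1, τ = (k : ℕ) + s := by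
  rcases eq_or_lt_of_le h.2 with e | e
  · exact ⟨Fin.last m, 1, ⟨zero_le_one, le_rfl⟩, by simpa using e⟩
  · refine ⟨⟨⌊τ⌋₊, ?_⟩, τ - ⌊τ⌋₊, ⟨?_, ?_⟩, by simp⟩
    · rw [Nat.floor_lt h.1]; exact_mod_cast e
    · linarith [Nat.floor_le h.1]
    · linarith [Nat.lt_floor_add_one τ]

lemma add_mem_Icc (k : Fin (m + 1)) {s : ℝ} (hs : s ∈ Icc (0 : ℝ) 1) :
    (k : ℕ) + s ∈ Icc (0 : ℝ) (m + 1) := by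
  have h1 : ((k : ℕ) : ℝ) + 1 ≤ (m : ℝ) + 1 := by exact_mod_cast k.2
  have h2 : (0 : ℝ) ≤ (k : ℕ) := Nat.cast_nonneg _
  exact ⟨by linarith [hs.1], by linarith [hs.2]⟩

lemma pathVertex_succ (w : Equiv.Perm (Fin (m + 1))) (k : Fin (m + 1)) :
    pathVertex θ w ((k : ℕ) + 1) = pathVertex θ w k + dir θ (w k) := by
  unfold pathVertex
  have : (Finset.univ.filter fun i : Fin (m + 1) => i.val < (k : ℕ) + 1) =
      insert k (Finset.univ.filter fun i : Fin (m + 1) => i.val < (k : ℕ)) := by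
    ext i
    simp only [Finset.mem_filter, Finset.mem_univ, true_and, Finset.mem_insert, Fin.ext_iff]
    omega
  rw [this, Finset.sum_insert (by simp), add_comm]

lemma pathVertex_top (w : Equiv.Perm (Fin (m + 1))) :
    pathVertex θ w (m + 1) = pathVertex θ 1 (m + 1) := by
  unfold pathVertex
  have : (Finset.univ.filter fun i : Fin (m + 1) => i.val < m + 1) = Finset.univ := by
    ext i; simpa using i.is_le
  rw [this]
  exact Equiv.sum_comp w (dir θ)

lemma pathPoint_add (w : Equiv.Perm (Fin (m + 1))) (k : Fin (m + 1)) {s : ℝ}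
    (hs : s ∈ Icc (0 : ℝ) 1) :
    pathPoint θ w ((k : ℕ) + s) = pathVertex θ w k + (s : ℂ) * dir θ (w k) := by
  unfold pathPoint pathVertex
  rw [Finset.sum_filter, ← Fintype.sum_ite_eq' k fun i => (s : ℂ) * dir θ (w i),
    ← Finset.sum_add_distrib]
  refine Finset.sum_congr rfl fun i _ => ?_
  rw [ramp_add k hs]
  by_cases h : i < k
  · have h' : i ≠ k := h.ne
    have h'' : i.val < k.val := h
    simp [h, h', h'']
  · have h'' : ¬ i.val < k.val := h
    by_cases h' : i = k
    · simp [h']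
    · simp [h, h', h'']

lemma mem_pathSide_iff (w : Equiv.Perm (Fin (m + 1))) (k : Fin (m + 1)) (z : ℂ) :
    z ∈ pathSide θ w k ↔
      ∃ s ∈ Icc (0 : ℝ) 1, z = pathVertex θ w k + (s : ℂ) * dir θ (w k) := by
  unfold pathSide
  rw [pathVertex_succ, segment_eq_image']
  simp only [mem_image, add_sub_cancel_left, Complex.real_smul, eq_comm]

lemma mem_path_iff (w : Equiv.Perm (Fin (m + 1))) (z : ℂ) :
    z ∈ path θ w ↔ ∃ k : Fin (m + 1), ∃ s ∈ Icc (0 : ℝ) 1,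
      z = pathVertex θ w k + (s : ℂ) * dir θ (w k) := by
  simp only [path, mem_iUnion, mem_pathSide_iff]

lemma path_eq_image (w : Equiv.Perm (Fin (m + 1))) :
    path θ w = pathPoint θ w '' Icc (0 : ℝ) (m + 1) := by
  ext z
  rw [mem_path_iff]
  constructor
  · rintro ⟨k, s, hs, rfl⟩
    exact ⟨_, add_mem_Icc k hs, pathPoint_add w k hs⟩
  · rintro ⟨τ, hτ, rfl⟩
    obtain ⟨k, s, hs, rfl⟩ := exists_eq_add hτ
    exact ⟨k, s, hs, pathPoint_add w k hs⟩

lemma pathVertex_mem_path (w : Equiv.Perm (Fin (m + 1))) (k : Fin (m + 1)) :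
    pathVertex θ w k ∈ path θ w :=
  (mem_path_iff w _).2 ⟨k, 0, ⟨le_rfl, zero_le_one⟩, by simp⟩

lemma pathVertex_succ_mem_path (w : Equiv.Perm (Fin (m + 1))) (k : Fin (m + 1)) :
    pathVertex θ w ((k : ℕ) + 1) ∈ path θ w :=
  (mem_path_iff w _).2 ⟨k, 1, ⟨zero_le_one, le_rfl⟩, by simp [pathVertex_succ]⟩

lemma continuous_pathPoint (w : Equiv.Perm (Fin (m + 1))) : Continuous (pathPoint θ w) := by
  unfold pathPoint ramp
  fun_prop

lemma isCompact_path (w : Equiv.Perm (Fin (m + 1))) : IsCompact (path θ w) := by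
  rw [path_eq_image]
  exact isCompact_Icc.image (continuous_pathPoint w)

lemma pathPoint_im (w : Equiv.Perm (Fin (m + 1))) (τ : ℝ) :
    (pathPoint θ w τ).im = ∑ i, ramp τ i * (dir θ (w i)).im := by
  simp [pathPoint]

lemma pathPoint_im_lt (hθ : IsDirectionSystem θ) (w : Equiv.Perm (Fin (m + 1))) {τ τ' : ℝ}
    (h0 : 0 ≤ τ) (h : τ < τ') (h1 : τ' ≤ m + 1) :
    (pathPoint θ w τ').im < (pathPoint θ w τ).im := by
  rw [pathPoint_im, pathPoint_im]
  have hm : τ < m + 1 := h.trans_le h1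
  refine Finset.sum_lt_sum (fun i _ =>
    mul_le_mul_of_nonpos_right (ramp_mono i h.le) (dir_im_neg hθ _).le)
    ⟨⟨⌊τ⌋₊, ?_⟩, Finset.mem_univ _, mul_lt_mul_of_neg_right ?_ (dir_im_neg hθ _)⟩
  · rw [Nat.floor_lt h0]; exact_mod_cast hm
  · have a := Nat.floor_le h0
    have b := Nat.lt_floor_add_one τ
    unfold ramp
    simp only
    rw [min_eq_right (by linarith), max_eq_right (by linarith)]
    exact lt_max_of_lt_right (lt_min (by linarith) (by linarith))

/-- A path meets each horizontal line at most once. -/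
lemma path_unique (hθ : IsDirectionSystem θ) {w : Equiv.Perm (Fin (m + 1))} {z : ℂ} {r : ℝ}
    (h : z ∈ path θ w) (h' : z + r ∈ path θ w) : r = 0 := by
  rw [path_eq_image] at h h'
  obtain ⟨τ, hτ, rfl⟩ := h
  obtain ⟨τ', hτ', e⟩ := h'
  have him : (pathPoint θ w τ').im = (pathPoint θ w τ).im := by rw [e]; simp
  have : τ' = τ := by
    rcases lt_trichotomy τ τ' with h | h | h
    · exact absurd him (pathPoint_im_lt hθ w hτ.1 h hτ'.2).ne
    · exact h.symm
    · exact absurd him (pathPoint_im_lt hθ w hτ'.1 h hτ.2).ne'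
  rw [this] at e
  simpa using e

/-- The leftside boundary lies to the left of all points of the zonotope spanned by the sides, and
its points have unique coordinates there. -/
lemma nonneg_of_sum_eq (hθ : IsDirectionSystem θ) {a : Fin (m + 1) → ℝ}
    (ha : ∀ i, a i ∈ Icc (0 : ℝ) 1) {σ r : ℝ} (hσ : σ ∈ Icc (0 : ℝ) (m + 1))
    (e : ∑ i, (a i : ℂ) * dir θ i = pathPoint θ 1 σ + r) :
    0 ≤ r ∧ (r = 0 → ∀ i, a i = ramp σ i) := by
  obtain ⟨j, s, hs, rfl⟩ := exists_eq_add hσ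
  set d : Fin (m + 1) → ℝ := fun i => a i - ramp ((j : ℕ) + s) i with hd
  have e' : ∑ i, (d i : ℂ) * dir θ i = r := by
    have : ∑ i, (d i : ℂ) * dir θ i = ∑ i, (a i : ℂ) * dir θ i - pathPoint θ 1 ((j : ℕ) + s) := by
      rw [pathPoint, ← Finset.sum_sub_distrib]
      refine Finset.sum_congr rfl fun i _ => ?_
      simp only [hd, Equiv.Perm.coe_one, id_eq]
      push_cast
      ring
    rw [this, e]; ring
  have hre : ∑ i, d i * (dir θ i).re = r := by simpa using congrArg Complex.re e'
  have him : ∑ i, d i * (dir θ i).im = 0 := by simpa using congrArg Complex.im e'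
  -- Cross product with side `j`, on which the left point lies. Coordinates before `j` can only drop
  -- from 1 and those after `j` only rise from 0, and the cross products change sign in the same
  -- way, so no term is negative.
  have key : ∑ i, d i * ((dir θ j).re * (dir θ i).im - (dir θ j).im * (dir θ i).re) =
      -(dir θ j).im * r := by
    rw [← hre, Finset.mul_sum]
    have : ∑ i, (dir θ j).re * (d i * (dir θ i).im) = 0 := by rw [← Finset.mul_sum, him, mul_zero]
    rw [← add_zero (∑ i, -(dir θ j).im * _), ← this, ← Finset.sum_add_distrib]
    exact Finset.sum_congr rfl fun i _ => by ring
  have hlt : ∀ i, i < j → d i = a i - 1 := fun i h => by simp [hd, ramp_add j hs, h]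
  have hgt : ∀ i, j < i → d i = a i := fun i h => by
    simp [hd, ramp_add j hs, h.not_gt, h.ne']
  have hterm : ∀ i ∈ Finset.univ,
      0 ≤ d i * ((dir θ j).re * (dir θ i).im - (dir θ j).im * (dir θ i).re) := fun i _ => by
    rcases lt_trichotomy i j with h | h | h
    · have := cross_pos hθ h
      rw [hlt i h]
      exact mul_nonneg_of_nonpos_of_nonpos (by linarith [(ha i).2]) (by linarith)
    · subst h; rw [mul_comm (dir θ i).im, sub_self, mul_zero]
    · rw [hgt i h]
      exact mul_nonneg (ha i).1 (cross_pos hθ h).le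
  have hj := dir_im_neg hθ j
  constructor
  · have := Finset.sum_nonneg hterm
    rw [key] at this
    exact nonneg_of_mul_nonneg_right this (by linarith)
  · intro hr
    rw [hr, mul_zero, Finset.sum_eq_zero_iff_of_nonneg hterm] at key
    have hne : ∀ i, i ≠ j → d i = 0 := fun i h => by
      refine (mul_eq_zero.1 (key i (Finset.mem_univ i))).resolve_right ?_
      rcases lt_or_gt_of_ne h with h | h
      · have := cross_pos hθ h
        intro h0; linarith
      · exact (cross_pos hθ h).ne'
    -- The cross product is blind to the coordinate along side `j` itself; the vertical component
    -- recovers it.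
    have hjj : d j = 0 := by
      rw [Finset.sum_eq_single j (fun i _ h => by rw [hne i h, zero_mul]) (by simp)] at him
      exact (mul_eq_zero.1 him).resolve_right hj.ne
    intro i
    by_cases h : i = j
    · rw [h]; exact sub_eq_zero.1 hjj
    · exact sub_eq_zero.1 (hne i h)

lemma pathPoint_eq_sum (w : Equiv.Perm (Fin (m + 1))) (τ : ℝ) :
    pathPoint θ w τ = ∑ i, (ramp τ (w.symm i) : ℂ) * dir θ i := by
  rw [pathPoint, ← Equiv.sum_comp w fun i => (ramp τ (w.symm i) : ℂ) * dir θ i]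
  simp

/-- A path and the leftside boundary can only meet where they have the same sides above. -/
lemma ramp_eq_of_pathPoint_eq (hθ : IsDirectionSystem θ) {w : Equiv.Perm (Fin (m + 1))} {τ σ : ℝ}
    (hσ : σ ∈ Icc (0 : ℝ) (m + 1)) (e : pathPoint θ w τ = pathPoint θ 1 σ) (i : Fin (m + 1)) :
    ramp τ (w.symm i) = ramp σ i := by
  refine (nonneg_of_sum_eq hθ (a := fun i => ramp τ (w.symm i))
    (fun i => ⟨ramp_nonneg _ _, ramp_le_one _ _⟩) hσ (r := 0) ?_).2 rfl i
  rw [← pathPoint_eq_sum, e]; simp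

lemma sum_ramp {τ : ℝ} (h : τ ∈ Icc (0 : ℝ) (m + 1)) : ∑ i : Fin (m + 1), ramp τ i = τ := by
  obtain ⟨k, s, hs, rfl⟩ := exists_eq_add h
  have : ∀ i : Fin (m + 1), ramp ((k : ℕ) + s) i = (if i < k then 1 else 0) +
      if i = k then s else 0 := fun i => by
    rw [ramp_add k hs]
    by_cases h : i < k
    · simp [h, h.ne]
    · simp [h]
  simp_rw [this]
  rw [Finset.sum_add_distrib, Finset.sum_ite_eq', Finset.sum_boole]
  have : (Finset.univ.filter fun i : Fin (m + 1) => i < k) = Finset.Iio k := by ext; simp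
  simp [this]

/-- At a common point both paths have the same coordinates; these sum to the arc length, so the
point sits at the same `τ` on both. -/
lemma ramp_symm_eq (hθ : IsDirectionSystem θ) {w : Equiv.Perm (Fin (m + 1))} {τ : ℝ}
    (hτ : τ ∈ Icc (0 : ℝ) (m + 1)) (h : pathPoint θ w τ ∈ path θ 1) (i : Fin (m + 1)) :
    ramp τ i = ramp τ (w i) := by
  rw [path_eq_image] at h
  obtain ⟨σ, hσ, e⟩ := h
  have key := ramp_eq_of_pathPoint_eq hθ hσ e.symm
  have : τ = σ := by
    rw [← sum_ramp hτ, ← sum_ramp hσ, ← Equiv.sum_comp w.symm]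
    exact Finset.sum_congr rfl fun i _ => key i
  subst this
  simpa using key (w i)

lemma pathPoint_zero (w : Equiv.Perm (Fin (m + 1))) : pathPoint θ w 0 = 0 := by
  have := pathPoint_add (θ := θ) w 0 (s := 0) ⟨le_rfl, zero_le_one⟩
  simpa [pathVertex] using this

lemma pathPoint_top (w : Equiv.Perm (Fin (m + 1))) :
    pathPoint θ w (m + 1) = pathVertex θ 1 (m + 1) := by
  have := pathPoint_add (θ := θ) w (Fin.last m) (s := 1) ⟨zero_le_one, le_rfl⟩
  rw [← pathVertex_top w]
  have h2 := pathVertex_succ (θ := θ) w (Fin.last m)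
  simp only [Fin.val_last] at this h2
  rw [this, h2]; simp

/-- All paths cross the same horizontal lines. -/
lemma exists_add_mem_path (hθ : IsDirectionSystem θ) {w : Equiv.Perm (Fin (m + 1))}
    (w' : Equiv.Perm (Fin (m + 1))) {z : ℂ} (h : z ∈ path θ w) :
    ∃ r : ℝ, z + r ∈ path θ w' := by
  have hc : ContinuousOn (fun τ => (pathPoint θ w' τ).im) (Icc 0 ((m : ℝ) + 1)) :=
    (Complex.continuous_im.comp (continuous_pathPoint w')).continuousOn
  rw [path_eq_image] at h
  obtain ⟨τ, hτ, rfl⟩ := h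
  have hle : ∀ {a b : ℝ}, 0 ≤ a → a ≤ b → b ≤ m + 1 →
      (pathPoint θ w b).im ≤ (pathPoint θ w a).im := fun h0 h h1 => by
    rcases eq_or_lt_of_le h with h | h
    · rw [h]
    · exact (pathPoint_im_lt hθ w h0 h h1).le
  obtain ⟨σ, hσ, e⟩ := intermediate_value_Icc' (by positivity) hc
    (show (pathPoint θ w τ).im ∈ _ from ⟨by
      simpa only [pathPoint_top] using hle hτ.1 hτ.2 le_rfl, by
      simpa only [pathPoint_zero] using hle le_rfl hτ.1 hτ.2⟩)
  refine ⟨(pathPoint θ w' σ).re - (pathPoint θ w τ).re, ?_⟩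
  rw [path_eq_image]
  refine ⟨σ, hσ, Complex.ext ?_ ?_⟩
  · simp
  · simpa using e

/-- All paths lie to the right of the leftside boundary. -/
lemma exists_sub_mem_left (hθ : IsDirectionSystem θ) {w : Equiv.Perm (Fin (m + 1))} {z : ℂ}
    (h : z ∈ path θ w) : ∃ r : ℝ, 0 ≤ r ∧ z - r ∈ path θ 1 := by
  obtain ⟨r, hr⟩ := exists_add_mem_path hθ 1 h
  refine ⟨-r, ?_, by simpa using hr⟩
  rw [path_eq_image] at h hr
  obtain ⟨τ, -, rfl⟩ := h
  obtain ⟨σ, hσ, e⟩ := hr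
  refine (nonneg_of_sum_eq hθ (a := fun i => ramp τ (w.symm i))
    (fun i => ⟨ramp_nonneg _ _, ramp_le_one _ _⟩) hσ ?_).1
  rw [← pathPoint_eq_sum, e]
  simp

lemma mem_polygon_iff (w : Equiv.Perm (Fin (m + 1))) (z : ℂ) :
    z ∈ polygon θ w ↔
      (∃ a : ℝ, 0 ≤ a ∧ z - a ∈ path θ 1) ∧ ∃ b : ℝ, 0 ≤ b ∧ z + b ∈ path θ w := by
  constructor
  · rintro ⟨p, hp, q, hq, h1, h2, h3, h4⟩
    refine ⟨⟨z.re - p.re, by linarith, ?_⟩, q.re - z.re, by linarith, ?_⟩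
    · have : z - ((z.re - p.re : ℝ) : ℂ) = p := by apply Complex.ext <;> simp [h1]
      rw [this]; exact hp
    · have : z + ((q.re - z.re : ℝ) : ℂ) = q := by apply Complex.ext <;> simp [h2]
      rw [this]; exact hq
  · rintro ⟨⟨a, ha, hp⟩, b, hb, hq⟩
    exact ⟨_, hp, _, hq, by simp, by simp, by simpa using ha, by simpa using hb⟩

lemma path_one_subset_polygon (hθ : IsDirectionSystem θ) (w : Equiv.Perm (Fin (m + 1))) :
    path θ 1 ⊆ polygon θ w := fun z hz => by
  obtain ⟨r, hr⟩ := exists_add_mem_path hθ w hz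
  refine (mem_polygon_iff w z).2 ⟨⟨0, le_rfl, by simpa using hz⟩, r, ?_, hr⟩
  obtain ⟨s, hs, hs'⟩ := exists_sub_mem_left hθ hr
  have : r - s = 0 := path_unique hθ hz (by
    rw [add_sub_assoc] at hs'
    exact_mod_cast hs')
  linarith

lemma path_subset_polygon (hθ : IsDirectionSystem θ) (w : Equiv.Perm (Fin (m + 1))) :
    path θ w ⊆ polygon θ w := fun z hz =>
  (mem_polygon_iff w z).2 ⟨exists_sub_mem_left hθ hz, 0, le_rfl, by simpa using hz⟩

/-- The polygon is the image of a compact set: pairs of boundary points on one horizontal line,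
times a parameter in `[0, 1]`. Closedness lets inclusions be checked on interiors of tiles. -/
lemma isClosed_polygon (hθ : IsDirectionSystem θ) (w : Equiv.Perm (Fin (m + 1))) :
    IsClosed (polygon θ w) := by
  have hK : IsCompact (path θ 1 ×ˢ path θ w ∩ {x : ℂ × ℂ | x.1.im = x.2.im}) :=
    ((isCompact_path 1).prod (isCompact_path w)).inter_right
      (isClosed_eq (by fun_prop) (by fun_prop))
  have : polygon θ w = (fun x : (ℂ × ℂ) × ℝ => x.1.1 + x.2 * (x.1.2 - x.1.1)) ''
      ((path θ 1 ×ˢ path θ w ∩ {x : ℂ × ℂ | x.1.im = x.2.im}) ×ˢ Icc (0 : ℝ) 1) := by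
    ext z
    rw [mem_polygon_iff]
    constructor
    · rintro ⟨⟨a, ha, hp⟩, b, hb, hq⟩
      refine ⟨((z - a, z + b), a / (a + b)), ⟨⟨⟨hp, hq⟩, by simp⟩, by positivity, ?_⟩, ?_⟩
      · exact div_le_one_of_le₀ (by linarith) (by linarith)
      · rcases eq_or_lt_of_le (add_nonneg ha hb) with h | h
        · have h1 : a = 0 := by linarith
          have h2 : b = 0 := by linarith
          simp [h1, h2]
        · have : (a : ℂ) + b ≠ 0 := by exact_mod_cast h.ne'
          push_cast
          field_simp
          ring
    · rintro ⟨⟨⟨p, q⟩, s⟩, ⟨⟨⟨hp, hq⟩, e⟩, hs0, hs1⟩, rfl⟩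
      simp only [mem_ofPred_eq] at hp hq e hs0 hs1 ⊢
      obtain ⟨r, hr, hr'⟩ := exists_sub_mem_left hθ hq
      have e1 : q = p + ((q.re - p.re : ℝ) : ℂ) := by apply Complex.ext <;> simp [e]
      have h0 : q.re - p.re - r = 0 := path_unique hθ hp (by
        push_cast at e1 ⊢
        convert hr' using 1
        nth_rewrite 2 [e1]; ring)
      have hle : 0 ≤ q.re - p.re := by linarith
      set d := q.re - p.re with hd
      clear_value d
      subst e1
      refine ⟨⟨s * d, mul_nonneg hs0 hle, ?_⟩, (1 - s) * d, mul_nonneg (by linarith) hle, ?_⟩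
      · convert hp using 1; push_cast; ring
      · convert hq using 1; push_cast; ring
  rw [this]
  exact ((hK.prod isCompact_Icc).image (by fun_prop)).isClosed

/-- The two boundaries of a polygon of a fully supported permutation meet only at the ends. -/
lemma notMem_left_of_fullySupported (hm : 1 ≤ m) (hθ : IsDirectionSystem θ)
    {w : Equiv.Perm (Fin (m + 1))} (hw : FullySupported w) {τ : ℝ} (hτ : τ ∈ Ioo (0 : ℝ) (m + 1)) :
    pathPoint θ w τ ∉ path θ 1 := fun h => by
  have key := ramp_symm_eq hθ ⟨hτ.1.le, hτ.2.le⟩ h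
  have aux : ∀ S : Set (Fin (m + 1)), (∀ i, i ∈ S ↔ w i ∈ S) → w '' S = S := fun S hS => by
    ext j
    constructor
    · rintro ⟨i, hi, rfl⟩; exact (hS i).1 hi
    · exact fun hj => ⟨w.symm j, (hS _).2 (by simpa using hj), by simp⟩
  -- The sides entirely above the point form an initial segment stable under `w`, of size `⌊τ⌋₊`.
  -- This is empty for `τ < 1`, where the sides partly above the point, namely the first one alone,
  -- are used instead.
  by_cases h1 : 1 ≤ τ
  · have hr : ∀ i : Fin (m + 1), i.val < ⌊τ⌋₊ ↔ ramp τ i = 1 := fun i => by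
      rw [← Nat.succ_le_iff, Nat.le_floor_iff hτ.1.le]
      unfold ramp
      push_cast
      constructor
      · intro h
        rw [min_eq_left (by linarith), max_eq_right zero_le_one]
      · intro h
        by_contra h'
        push Not at h'
        have : max 0 (min 1 (τ - (i.val : ℝ))) < 1 :=
          max_lt one_pos ((min_le_right _ _).trans_lt (by linarith))
        linarith
    refine hw ⌊τ⌋₊ ((Nat.one_le_floor_iff τ).2 h1) ?_ (aux _ fun i => ?_)
    · rw [Nat.floor_lt hτ.1.le]; exact_mod_cast hτ.2
    · simp only [mem_ofPred_eq, hr, key i]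
  · have hr : ∀ i : Fin (m + 1), i.val < 1 ↔ 0 < ramp τ i := fun i => by
      unfold ramp
      rw [lt_max_iff, lt_min_iff]
      constructor
      · intro h
        have : i.val = 0 := by omega
        simpa [this] using hτ.1
      · rintro (h | h)
        · exact absurd h (lt_irrefl _)
        · have : (i.val : ℝ) < 1 := by linarith [h.2]
          exact_mod_cast this
    refine hw 1 le_rfl (by omega) (aux _ fun i => ?_)
    simp only [mem_ofPred_eq, hr, key i]

end Paths

end Elnitsky

namespace Elnitsky

open Set Filter Topology

/-! ### Geometry of a single rhombus in its own coordinates. -/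

section Tiles

variable {n : ℕ} {θ : Fin n → ℝ}

/-- The point of the plane with given coordinates with respect to a tile. -/
noncomputable def Tile.point (θ : Fin n → ℝ) (t : Tile n) (a b : ℝ) : ℂ :=
  t.top + (a : ℂ) * dir θ t.lo + (b : ℂ) * dir θ t.hi

lemma Tile.point_mem (t : Tile n) {a b : ℝ} (ha : a ∈ Icc (0 : ℝ) 1) (hb : b ∈ Icc (0 : ℝ) 1) :
    t.point θ a b ∈ t.region θ := ⟨a, ha, b, hb, rfl⟩

lemma Tile.point_inj (hθ : IsDirectionSystem θ) (t : Tile n) {a b a' b' : ℝ}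
    (h : t.point θ a b = t.point θ a' b') : a = a' ∧ b = b' := by
  have := dir_combination_eq_zero hθ t.lo_lt_hi.ne (a := a - a') (b := b - b') (by
    unfold Tile.point at h
    push_cast
    linear_combination h)
  exact ⟨sub_eq_zero.1 this.1, sub_eq_zero.1 this.2⟩

lemma Tile.exists_coords (hθ : IsDirectionSystem θ) (t : Tile n) :
    ∃ A B : ℂ → ℝ, Continuous A ∧ Continuous B ∧ ∀ z, z = t.point θ (A z) (B z) := by
  have hD := (cross_pos hθ t.lo_lt_hi).ne'
  set D := (dir θ t.lo).re * (dir θ t.hi).im - (dir θ t.lo).im * (dir θ t.hi).re with hDdef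
  refine ⟨fun z => ((z - t.top).re * (dir θ t.hi).im - (z - t.top).im * (dir θ t.hi).re) / D,
    fun z => ((dir θ t.lo).re * (z - t.top).im - (dir θ t.lo).im * (z - t.top).re) / D,
    by fun_prop, by fun_prop, fun z => ?_⟩
  unfold Tile.point
  apply Complex.ext
  · simp only [Complex.add_re, Complex.re_ofReal_mul, Complex.sub_re, Complex.sub_im]
    field_simp
    rw [hDdef]; ring
  · simp only [Complex.add_im, Complex.im_ofReal_mul, Complex.sub_re, Complex.sub_im]
    field_simp
    rw [hDdef]; ring

lemma Tile.isClosed_region (hθ : IsDirectionSystem θ) (t : Tile n) : IsClosed (t.region θ) := by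
  obtain ⟨A, B, hA, hB, h⟩ := t.exists_coords hθ
  have : t.region θ = A ⁻¹' Icc 0 1 ∩ B ⁻¹' Icc 0 1 := by
    ext z
    constructor
    · rintro ⟨a, ha, b, hb, e⟩
      obtain ⟨rfl, rfl⟩ := t.point_inj hθ ((h z).symm.trans e)
      exact ⟨ha, hb⟩
    · rintro ⟨ha, hb⟩
      exact ⟨_, ha, _, hb, h z⟩
  rw [this]
  exact (isClosed_Icc.preimage hA).inter (isClosed_Icc.preimage hB)

lemma Tile.point_mem_interior (hθ : IsDirectionSystem θ) (t : Tile n) {a b : ℝ}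
    (ha : a ∈ Ioo (0 : ℝ) 1) (hb : b ∈ Ioo (0 : ℝ) 1) :
    t.point θ a b ∈ interior (t.region θ) := by
  obtain ⟨A, B, hA, hB, h⟩ := t.exists_coords hθ
  refine mem_interior.2 ⟨A ⁻¹' Ioo 0 1 ∩ B ⁻¹' Ioo 0 1, fun z hz => ?_,
    (isOpen_Ioo.preimage hA).inter (isOpen_Ioo.preimage hB), ?_⟩
  · rw [h z]
    exact t.point_mem (Ioo_subset_Icc_self hz.1) (Ioo_subset_Icc_self hz.2)
  · obtain ⟨e1, e2⟩ := t.point_inj hθ (h (t.point θ a b))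
    exact ⟨by rwa [mem_preimage, ← e1], by rwa [mem_preimage, ← e2]⟩

lemma Tile.region_subset_closure_interior (hθ : IsDirectionSystem θ) (t : Tile n) :
    t.region θ ⊆ closure (interior (t.region θ)) := by
  rintro z ⟨a, ha, b, hb, rfl⟩
  -- Contraction towards the centre `(1/2, 1/2)` of the rhombus by the factor `1 - δ`.
  have hc : Continuous fun δ : ℝ => t.point θ ((1 - δ) * a + δ / 2) ((1 - δ) * b + δ / 2) := by
    unfold Tile.point; fun_prop
  have ht := (hc.tendsto 0).mono_left (nhdsWithin_le_nhds (s := Ioi 0))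
  simp only [sub_zero, one_mul, zero_div, add_zero] at ht
  refine mem_closure_of_tendsto ht ?_
  filter_upwards [Ioo_mem_nhdsGT (zero_lt_one' ℝ)] with δ hδ
  have aux : ∀ x ∈ Icc (0 : ℝ) 1, (1 - δ) * x + δ / 2 ∈ Ioo (0 : ℝ) 1 := fun x hx => by
    have h1 := mul_nonneg (sub_nonneg.2 hδ.2.le) hx.1
    have h2 := mul_le_mul_of_nonneg_left hx.2 (sub_nonneg.2 hδ.2.le)
    exact ⟨by linarith [hδ.1], by linarith [hδ.1]⟩
  exact t.point_mem_interior hθ (aux a ha) (aux b hb)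

/-- Moving right lowers the `lo` coordinate and raises the `hi` coordinate at constant rates. Hence
the right edges are `a = 0` (upper) and `b = 1` (lower), and the left edges are `b = 0` (upper) and
`a = 1` (lower). -/
lemma Tile.exists_shift (hθ : IsDirectionSystem θ) (t : Tile n) :
    ∃ α > (0 : ℝ), ∃ β > (0 : ℝ), ∀ a b ε : ℝ,
      t.point θ a b + ε = t.point θ (a - ε * β) (b + ε * α) := by
  obtain ⟨α, hα, β, hβ, e⟩ := exists_one_eq hθ t.lo_lt_hi
  refine ⟨α, hα, β, hβ, fun a b ε => ?_⟩
  unfold Tile.point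
  push_cast
  linear_combination (ε : ℂ) * e

/-- Slightly to the left of a point of the right edges, other than the ends, lies the interior. -/
lemma Tile.eventually_sub_mem_interior (hθ : IsDirectionSystem θ) (t : Tile n) {a b : ℝ}
    (ha : a ∈ Ico (0 : ℝ) 1) (hb : b ∈ Ioc (0 : ℝ) 1) :
    ∀ᶠ ε : ℝ in 𝓝[>] 0, t.point θ a b - ε ∈ interior (t.region θ) := by
  obtain ⟨α, hα, β, hβ, e⟩ := t.exists_shift hθ
  have h1 : ∀ᶠ ε : ℝ in 𝓝[>] 0, a + ε * β < 1 :=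
    nhdsWithin_le_nhds ((Continuous.tendsto (by fun_prop) 0).eventually_lt_const
      (by simpa using ha.2))
  have h2 : ∀ᶠ ε : ℝ in 𝓝[>] 0, 0 < b - ε * α :=
    nhdsWithin_le_nhds ((Continuous.tendsto (by fun_prop) 0).eventually_const_lt
      (by simpa using hb.1))
  filter_upwards [h1, h2, self_mem_nhdsWithin] with ε h1 h2 h3
  have h3 : 0 < ε := h3
  have p1 := mul_pos h3 hα
  have p2 := mul_pos h3 hβ
  have : t.point θ a b - ε = t.point θ (a + ε * β) (b - ε * α) := by
    have := e a b (-ε)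
    push_cast at this
    rw [sub_eq_add_neg, this]
    congr 1 <;> ring
  rw [this]
  exact t.point_mem_interior hθ ⟨by linarith [ha.1], h1⟩ ⟨h2, by linarith [hb.2]⟩

lemma Tile.eventually_add_mem_interior (hθ : IsDirectionSystem θ) (t : Tile n) {a b : ℝ}
    (ha : a ∈ Ioc (0 : ℝ) 1) (hb : b ∈ Ico (0 : ℝ) 1) :
    ∀ᶠ ε : ℝ in 𝓝[>] 0, t.point θ a b + ε ∈ interior (t.region θ) := by
  obtain ⟨α, hα, β, hβ, e⟩ := t.exists_shift hθ
  have h1 : ∀ᶠ ε : ℝ in 𝓝[>] 0, 0 < a - ε * β :=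
    nhdsWithin_le_nhds ((Continuous.tendsto (by fun_prop) 0).eventually_const_lt
      (by simpa using ha.1))
  have h2 : ∀ᶠ ε : ℝ in 𝓝[>] 0, b + ε * α < 1 :=
    nhdsWithin_le_nhds ((Continuous.tendsto (by fun_prop) 0).eventually_lt_const
      (by simpa using hb.2))
  filter_upwards [h1, h2, self_mem_nhdsWithin] with ε h1 h2 h3
  have h3 : 0 < ε := h3
  have p1 := mul_pos h3 hα
  have p2 := mul_pos h3 hβ
  rw [e]
  exact t.point_mem_interior hθ ⟨h1, by linarith [ha.2]⟩ ⟨by linarith [hb.1], h2⟩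

lemma Tile.exists_slide_right (hθ : IsDirectionSystem θ) (t : Tile n) {z : ℂ}
    (hz : z ∈ t.region θ) : ∃ ε : ℝ, 0 ≤ ε ∧
      ((∃ b ∈ Icc (0 : ℝ) 1, z + ε = t.point θ 0 b) ∨
        ∃ a ∈ Icc (0 : ℝ) 1, z + ε = t.point θ a 1) := by
  obtain ⟨a, ha, b, hb, e⟩ := hz
  change z = t.point θ a b at e
  subst e
  obtain ⟨α, hα, β, hβ, e⟩ := t.exists_shift hθ
  rcases le_total (a / β) ((1 - b) / α) with h | h
  · refine ⟨a / β, div_nonneg ha.1 hβ.le, .inl ⟨b + a / β * α, ⟨?_, ?_⟩, ?_⟩⟩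
    · have := mul_nonneg (div_nonneg ha.1 hβ.le) hα.le
      linarith [hb.1]
    · rw [le_div_iff₀ hα] at h
      linarith
    · rw [e, div_mul_cancel₀ _ hβ.ne', sub_self]
  · have h0 := div_nonneg (sub_nonneg.2 hb.2) hα.le
    refine ⟨(1 - b) / α, h0, .inr ⟨a - (1 - b) / α * β, ⟨?_, ?_⟩, ?_⟩⟩
    · rw [le_div_iff₀ hβ] at h
      linarith
    · have := mul_nonneg h0 hβ.le
      linarith [ha.2]
    · rw [e, div_mul_cancel₀ _ hα.ne']
      congr 1; ring

lemma Tile.exists_slide_left (hθ : IsDirectionSystem θ) (t : Tile n) {z : ℂ}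
    (hz : z ∈ t.region θ) : ∃ ε : ℝ, 0 ≤ ε ∧
      ((∃ b ∈ Icc (0 : ℝ) 1, z - ε = t.point θ 1 b) ∨
        ∃ a ∈ Icc (0 : ℝ) 1, z - ε = t.point θ a 0) ∧
      ∀ δ ∈ Icc 0 ε, z - δ ∈ t.region θ := by
  obtain ⟨a, ha, b, hb, e⟩ := hz
  change z = t.point θ a b at e
  subst e
  obtain ⟨α, hα, β, hβ, e⟩ := t.exists_shift hθ
  have e' : ∀ ε : ℝ, t.point θ a b - ε = t.point θ (a + ε * β) (b - ε * α) := fun ε => by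
    have := e a b (-ε)
    push_cast at this
    rw [sub_eq_add_neg, this]
    congr 1 <;> ring
  have conv : ∀ ε : ℝ, a + ε * β ≤ 1 → 0 ≤ b - ε * α →
      ∀ δ ∈ Icc 0 ε, t.point θ a b - δ ∈ t.region θ := fun ε h1 h2 δ hδ => by
    rw [e']
    have p1 := mul_le_mul_of_nonneg_right hδ.2 hβ.le
    have p2 := mul_le_mul_of_nonneg_right hδ.2 hα.le
    have p3 := mul_nonneg hδ.1 hβ.le
    have p4 := mul_nonneg hδ.1 hα.le
    exact t.point_mem ⟨by linarith [ha.1], by linarith⟩ ⟨by linarith, by linarith [hb.2]⟩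
  rcases le_total ((1 - a) / β) (b / α) with h | h
  · have h0 := div_nonneg (sub_nonneg.2 ha.2) hβ.le
    have h1 : (1 - a) / β * β = 1 - a := div_mul_cancel₀ _ hβ.ne'
    have h2 : (1 - a) / β * α ≤ b := by rwa [le_div_iff₀ hα] at h
    refine ⟨(1 - a) / β, h0, .inl ⟨b - (1 - a) / β * α, ⟨by linarith, ?_⟩, ?_⟩,
      conv _ (by linarith) (by linarith)⟩
    · linarith [mul_nonneg h0 hα.le, hb.2]
    · rw [e', h1]
      congr 1; ring
  · have h0 := div_nonneg hb.1 hα.le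
    have h1 : b / α * α = b := div_mul_cancel₀ _ hα.ne'
    have h2 : b / α * β ≤ 1 - a := by rwa [le_div_iff₀ hβ] at h
    refine ⟨b / α, h0, .inr ⟨a + b / α * β, ⟨?_, by linarith⟩, ?_⟩,
      conv _ (by linarith) (by linarith)⟩
    · linarith [mul_nonneg h0 hβ.le, ha.1]
    · rw [e', h1, sub_self]

/-- Tiles with disjoint interiors cannot both have a common point on their right edges, unless it
is an end. -/
lemma Tile.not_disjoint_interior (hθ : IsDirectionSystem θ) {s t : Tile n} {a b a' b' : ℝ}
    (ha : a ∈ Ico (0 : ℝ) 1) (hb : b ∈ Ioc (0 : ℝ) 1) (ha' : a' ∈ Ico (0 : ℝ) 1)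
    (hb' : b' ∈ Ioc (0 : ℝ) 1) (e : s.point θ a b = t.point θ a' b') :
    ¬ Disjoint (interior (s.region θ)) (interior (t.region θ)) := by
  obtain ⟨ε, h1, h2⟩ := ((s.eventually_sub_mem_interior hθ ha hb).and
    (t.eventually_sub_mem_interior hθ ha' hb')).exists
  rw [← e] at h2
  exact Set.not_disjoint_iff.2 ⟨_, h1, h2⟩

end Tiles

/-! ### Tilings, and adding or erasing the tile of a descent. -/

section Tilings

variable {m : ℕ} {θ : Fin (m + 1) → ℝ} {w : Equiv.Perm (Fin (m + 1))}

/-- Just to the right of such a point lies the interior of the tile, hence the polygon, whereas a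
point of the rightside boundary is the last polygon point on its line. -/
lemma Tile.point_notMem_right (hθ : IsDirectionSystem θ) {t : Tile (m + 1)}
    (ht : t.region θ ⊆ polygon θ w) {a b : ℝ} (ha : a ∈ Ioc (0 : ℝ) 1) (hb : b ∈ Ico (0 : ℝ) 1) :
    t.point θ a b ∉ path θ w := fun h => by
  obtain ⟨ε, h1, h0⟩ := ((t.eventually_add_mem_interior hθ ha hb).and self_mem_nhdsWithin).exists
  have h0 : 0 < ε := h0
  obtain ⟨-, r, hr, hr'⟩ := (mem_polygon_iff w _).1 (ht (interior_subset h1))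
  have := path_unique hθ h (r := ε + r) (by rw [add_assoc] at hr'; exact_mod_cast hr')
  linarith

lemma Tile.point_notMem_left (hθ : IsDirectionSystem θ) {t : Tile (m + 1)}
    (ht : t.region θ ⊆ polygon θ w) {a b : ℝ} (ha : a ∈ Ico (0 : ℝ) 1) (hb : b ∈ Ioc (0 : ℝ) 1) :
    t.point θ a b ∉ path θ 1 := fun h => by
  obtain ⟨ε, h1, h0⟩ := ((t.eventually_sub_mem_interior hθ ha hb).and self_mem_nhdsWithin).exists
  have h0 : 0 < ε := h0
  obtain ⟨⟨r, hr, hr'⟩, -⟩ := (mem_polygon_iff w _).1 (ht (interior_subset h1))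
  have := path_unique hθ h (r := -(ε + r)) (by
    convert hr' using 1
    push_cast; ring)
  linarith

/-- Rhombic tilings of polygons that may be degenerate to segments in places. -/
structure IsTilingOffLeft (θ : Fin (m + 1) → ℝ) (w : Equiv.Perm (Fin (m + 1)))
    (T : Finset (Tile (m + 1))) : Prop where
  subset : ∀ t ∈ T, t.region θ ⊆ polygon θ w
  cover : ∀ z ∈ polygon θ w, z ∉ path θ 1 → ∃ t ∈ T, z ∈ t.region θ
  disjoint : ∀ s ∈ T, ∀ t ∈ T, s ≠ t → Disjoint (interior (s.region θ)) (interior (t.region θ))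

lemma IsTilingOffLeft.eq_of_point_eq (hθ : IsDirectionSystem θ) {T : Finset (Tile (m + 1))}
    (h : IsTilingOffLeft θ w T) {s t : Tile (m + 1)} (hs : s ∈ T) (ht : t ∈ T) {a b a' b' : ℝ}
    (ha : a ∈ Ico (0 : ℝ) 1) (hb : b ∈ Ioc (0 : ℝ) 1) (ha' : a' ∈ Ico (0 : ℝ) 1)
    (hb' : b' ∈ Ioc (0 : ℝ) 1) (e : s.point θ a b = t.point θ a' b') : s = t := by
  by_contra hne
  exact Tile.not_disjoint_interior hθ ha hb ha' hb' e (h.disjoint s hs t ht hne)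

lemma IsRhombicTiling.isTilingOffLeft {T : Finset (Tile (m + 1))} (h : IsRhombicTiling θ w T) :
    IsTilingOffLeft θ w T where
  subset t ht := h.1 ▸ subset_biUnion_of_mem (u := fun t : Tile (m + 1) => t.region θ) ht
  cover z hz _ := by
    rw [← h.1] at hz
    simpa using hz
  disjoint := h.2

lemma isClosed_biUnion_region (hθ : IsDirectionSystem θ) (T : Finset (Tile (m + 1))) :
    IsClosed (⋃ t ∈ T, t.region θ) :=
  isClosed_biUnion_finset fun t _ => t.isClosed_region hθ

/-- Full support gives the polygon positive width at every height strictly between its ends. Points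
of the leftside boundary there are limits from the right of covered points, and the union of the
tiles is closed; the two ends follow by another closure. -/
lemma IsTilingOffLeft.isRhombicTiling (hm : 1 ≤ m) (hθ : IsDirectionSystem θ)
    (hw : FullySupported w) {T : Finset (Tile (m + 1))} (h : IsTilingOffLeft θ w T) :
    IsRhombicTiling θ w T := by
  refine ⟨(iUnion₂_subset h.subset).antisymm fun z hz => ?_, h.disjoint⟩
  by_cases hz1 : z ∈ path θ 1
  · have hcl : IsClosed (pathPoint θ 1 ⁻¹' ⋃ t ∈ T, t.region θ) :=
      (isClosed_biUnion_region hθ T).preimage (continuous_pathPoint 1)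
    have hsub : Ioo (0 : ℝ) (m + 1) ⊆ pathPoint θ 1 ⁻¹' ⋃ t ∈ T, t.region θ := fun σ hσ => by
      have hp : pathPoint θ 1 σ ∈ path θ 1 := by
        rw [path_eq_image]
        exact mem_image_of_mem _ (Ioo_subset_Icc_self hσ)
      obtain ⟨-, r, hr0, hr⟩ := (mem_polygon_iff w _).1 (path_one_subset_polygon hθ w hp)
      have hr1 : 0 < r := by
        refine lt_of_le_of_ne hr0 fun e => ?_
        rw [← e, Complex.ofReal_zero, add_zero, path_eq_image] at hr
        obtain ⟨τ, hτ, hτ'⟩ := hr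
        have him := congrArg Complex.im hτ'
        refine notMem_left_of_fullySupported hm hθ hw (τ := τ) ⟨?_, ?_⟩ (hτ' ▸ hp)
        · refine lt_of_le_of_ne hτ.1 fun e => ?_
          have := pathPoint_im_lt hθ 1 le_rfl hσ.1 hσ.2.le
          rw [← e, pathPoint_zero] at him
          rw [pathPoint_zero] at this
          exact this.ne him.symm
        · refine lt_of_le_of_ne hτ.2 fun e => ?_
          have := pathPoint_im_lt hθ 1 hσ.1.le hσ.2 le_rfl
          rw [e, pathPoint_top] at him
          rw [pathPoint_top] at this
          exact this.ne him
      have ht : Tendsto (fun ε : ℝ => pathPoint θ 1 σ + ε) (𝓝[>] 0) (𝓝 (pathPoint θ 1 σ)) := by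
        have hc : Continuous fun ε : ℝ => pathPoint θ 1 σ + ε := by fun_prop
        simpa using (hc.tendsto 0).mono_left (nhdsWithin_le_nhds (s := Ioi 0))
      refine (isClosed_biUnion_region hθ T).mem_of_tendsto ht ?_
      filter_upwards [Ioo_mem_nhdsGT hr1] with ε hε
      have := h.cover (pathPoint θ 1 σ + ε) ((mem_polygon_iff w _).2
        ⟨⟨ε, hε.1.le, by simpa using hp⟩, r - ε, by linarith [hε.2], by
          convert hr using 1; push_cast; ring⟩)
        fun h' => hε.1.ne' (path_unique hθ hp h')
      simpa using this
    have := closure_minimal hsub hcl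
    rw [closure_Ioo (by positivity)] at this
    rw [path_eq_image] at hz1
    obtain ⟨σ, hσ, rfl⟩ := hz1
    exact this hσ
  · simpa using h.cover z hz hz1

/-- The tile enclosed by two consecutive sides of a path and by the same sides in opposite order. -/
noncomputable def swapTile (θ : Fin (m + 1) → ℝ) (w : Equiv.Perm (Fin (m + 1)))
    {k k' : Fin (m + 1)} (h : w k' < w k) : Tile (m + 1) :=
  ⟨pathVertex θ w k, w k', w k, h⟩

lemma pathVertex_mul_swap (w : Equiv.Perm (Fin (m + 1))) {k k' : Fin (m + 1)}
    (hk : k'.val = k.val + 1) {j : ℕ} (hj : j ≠ k') :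
    pathVertex θ (w * Equiv.swap k k') j = pathVertex θ w j := by
  unfold pathVertex
  refine Finset.sum_equiv (Equiv.swap k k') (fun i => ?_) fun i _ => rfl
  simp only [Finset.mem_filter, Finset.mem_univ, true_and]
  rcases eq_or_ne i k with rfl | h1
  · rw [Equiv.swap_apply_left]; omega
  rcases eq_or_ne i k' with rfl | h2
  · rw [Equiv.swap_apply_right]; omega
  · rw [Equiv.swap_apply_of_ne_of_ne h1 h2]

lemma mem_path_mul_swap (w : Equiv.Perm (Fin (m + 1))) {k k' : Fin (m + 1)}
    (hk : k'.val = k.val + 1) {z : ℂ} (hz : z ∈ path θ w) :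
    z ∈ path θ (w * Equiv.swap k k') ∨
      (∃ b ∈ Icc (0 : ℝ) 1, z = pathVertex θ w k + (b : ℂ) * dir θ (w k)) ∨
      ∃ a ∈ Icc (0 : ℝ) 1,
        z = pathVertex θ w k + (a : ℂ) * dir θ (w k') + dir θ (w k) := by
  obtain ⟨j, s, hs, rfl⟩ := (mem_path_iff w z).1 hz
  rcases eq_or_ne j k with rfl | h1
  · exact .inr (.inl ⟨s, hs, rfl⟩)
  rcases eq_or_ne j k' with rfl | h2
  · refine .inr (.inr ⟨s, hs, ?_⟩)
    rw [hk, pathVertex_succ]; ring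
  · refine .inl ((mem_path_iff _ _).2 ⟨j, s, hs, ?_⟩)
    rw [pathVertex_mul_swap w hk fun h => h2 (Fin.ext h), Equiv.Perm.mul_apply,
      Equiv.swap_apply_of_ne_of_ne h1 h2]

variable {k k' : Fin (m + 1)}

lemma swapTile_point_zero_mem (h : w k' < w k) {b : ℝ} (hb : b ∈ Icc (0 : ℝ) 1) :
    (swapTile θ w h).point θ 0 b ∈ path θ w :=
  (mem_path_iff _ _).2 ⟨k, b, hb, by simp [Tile.point, swapTile]⟩

lemma swapTile_point_one_mem (hk : k'.val = k.val + 1) (h : w k' < w k) {a : ℝ}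
    (ha : a ∈ Icc (0 : ℝ) 1) : (swapTile θ w h).point θ a 1 ∈ path θ w :=
  (mem_path_iff _ _).2 ⟨k', a, ha, by
    rw [hk, pathVertex_succ]
    simp only [Tile.point, swapTile, Complex.ofReal_one]; ring⟩

lemma swapTile_point_mem_swap_zero (hk : k'.val = k.val + 1) (h : w k' < w k) {a : ℝ}
    (ha : a ∈ Icc (0 : ℝ) 1) :
    (swapTile θ w h).point θ a 0 ∈ path θ (w * Equiv.swap k k') :=
  (mem_path_iff _ _).2 ⟨k, a, ha, by
    rw [pathVertex_mul_swap w hk (by omega)]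
    simp [Tile.point, swapTile]⟩

lemma swapTile_point_mem_swap_one (hk : k'.val = k.val + 1) (h : w k' < w k) {b : ℝ}
    (hb : b ∈ Icc (0 : ℝ) 1) :
    (swapTile θ w h).point θ 1 b ∈ path θ (w * Equiv.swap k k') :=
  (mem_path_iff _ _).2 ⟨k', b, hb, by
    rw [hk, pathVertex_succ, pathVertex_mul_swap w hk (by omega)]
    simp [Tile.point, swapTile]⟩

lemma exists_add_mem_path_of_mem_swapTile (hθ : IsDirectionSystem θ) (hk : k'.val = k.val + 1)
    (h : w k' < w k) {z : ℂ} (hz : z ∈ (swapTile θ w h).region θ) :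
    ∃ ε : ℝ, 0 ≤ ε ∧ z + ε ∈ path θ w := by
  obtain ⟨ε, hε, ⟨b, hb, e⟩ | ⟨a, ha, e⟩⟩ := Tile.exists_slide_right hθ _ hz
  · exact ⟨ε, hε, e ▸ swapTile_point_zero_mem h hb⟩
  · exact ⟨ε, hε, e ▸ swapTile_point_one_mem hk h ha⟩

lemma exists_sub_mem_path_of_mem_swapTile (hθ : IsDirectionSystem θ) (hk : k'.val = k.val + 1)
    (h : w k' < w k) {z : ℂ} (hz : z ∈ (swapTile θ w h).region θ) :
    ∃ ε : ℝ, 0 ≤ ε ∧ z - ε ∈ path θ (w * Equiv.swap k k') ∧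
      ∀ δ ∈ Icc 0 ε, z - δ ∈ (swapTile θ w h).region θ := by
  obtain ⟨ε, hε, ⟨b, hb, e⟩ | ⟨a, ha, e⟩, hc⟩ := Tile.exists_slide_left hθ _ hz
  · exact ⟨ε, hε, e ▸ swapTile_point_mem_swap_one hk h hb, hc⟩
  · exact ⟨ε, hε, e ▸ swapTile_point_mem_swap_zero hk h ha, hc⟩

/-- A polygon is obtained by adding one tile to the polygon of a permutation with one inversion
less. -/
lemma polygon_eq_union (hθ : IsDirectionSystem θ) (hk : k'.val = k.val + 1) (h : w k' < w k) :
    polygon θ w = polygon θ (w * Equiv.swap k k') ∪ (swapTile θ w h).region θ := by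
  ext z
  constructor
  · intro hz
    obtain ⟨hl, b, hb, hq⟩ := (mem_polygon_iff w z).1 hz
    have key : z + b ∈ (swapTile θ w h).region θ →
        z ∈ polygon θ (w * Equiv.swap k k') ∪ (swapTile θ w h).region θ := fun hq => by
      obtain ⟨ε, hε, h1, h2⟩ := exists_sub_mem_path_of_mem_swapTile hθ hk h hq
      rcases le_total b ε with hle | hle
      · exact .inr (by simpa using h2 b ⟨hb, hle⟩)
      · exact .inl ((mem_polygon_iff _ z).2 ⟨hl, b - ε, by linarith, by
          convert h1 using 1; push_cast; ring⟩)
    rcases mem_path_mul_swap w hk hq with hq | ⟨b', hb', e⟩ | ⟨a', ha', e⟩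
    · exact .inl ((mem_polygon_iff _ z).2 ⟨hl, b, hb, hq⟩)
    · exact key ⟨0, ⟨le_rfl, zero_le_one⟩, b', hb', by rw [e]; simp [swapTile]⟩
    · exact key ⟨a', ha', 1, ⟨zero_le_one, le_rfl⟩, by rw [e]; simp [swapTile]⟩
  · rintro (hz | hz)
    · obtain ⟨hl, b, hb, hq⟩ := (mem_polygon_iff _ z).1 hz
      refine (mem_polygon_iff _ z).2 ⟨hl, ?_⟩
      have key : z + b ∈ (swapTile θ w h).region θ → ∃ b : ℝ, 0 ≤ b ∧ z + b ∈ path θ w :=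
        fun hq => by
          obtain ⟨ε, hε, h1⟩ := exists_add_mem_path_of_mem_swapTile hθ hk h hq
          exact ⟨b + ε, by linarith, by rw [add_assoc] at h1; exact_mod_cast h1⟩
      have e0 : pathVertex θ (w * Equiv.swap k k') k = pathVertex θ w k :=
        pathVertex_mul_swap w hk (by omega)
      rcases mem_path_mul_swap _ hk hq with hq | ⟨a', ha', e⟩ | ⟨b', hb', e⟩
      · rw [mul_assoc, Equiv.swap_mul_self, mul_one] at hq
        exact ⟨b, hb, hq⟩
      · exact key ⟨a', ha', 0, ⟨le_rfl, zero_le_one⟩, by rw [e, e0]; simp [swapTile]⟩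
      · exact key ⟨1, ⟨zero_le_one, le_rfl⟩, b', hb', by
          rw [e, e0]; simp only [swapTile, Equiv.Perm.mul_apply, Equiv.swap_apply_left,
            Equiv.swap_apply_right, Complex.ofReal_one]; ring⟩
    · obtain ⟨ε, hε, h1, -⟩ := exists_sub_mem_path_of_mem_swapTile hθ hk h hz
      obtain ⟨r, hr, h2⟩ := exists_sub_mem_left hθ h1
      exact (mem_polygon_iff _ z).2 ⟨⟨ε + r, by linarith, by
        rw [sub_sub] at h2; exact_mod_cast h2⟩, exists_add_mem_path_of_mem_swapTile hθ hk h hz⟩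

/-- Points to the right of a point of the swapped tile lie outside the smaller polygon. -/
lemma notMem_polygon_of_sub_mem (hθ : IsDirectionSystem θ) (hk : k'.val = k.val + 1)
    (h : w k' < w k) {z : ℂ} {ε : ℝ} (hε : 0 < ε) (hz : z - ε ∈ (swapTile θ w h).region θ) :
    z ∉ polygon θ (w * Equiv.swap k k') := fun hz' => by
  obtain ⟨δ, hδ, h1, -⟩ := exists_sub_mem_path_of_mem_swapTile hθ hk h hz
  obtain ⟨-, b, hb, hq⟩ := (mem_polygon_iff _ z).1 hz'
  have := path_unique hθ hq (r := -(b + ε + δ)) (by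
    convert h1 using 1; push_cast; ring)
  linarith

lemma IsTilingOffLeft.insert_swapTile [DecidableEq (Tile (m + 1))] (hθ : IsDirectionSystem θ)
    (hk : k'.val = k.val + 1) (h : w k' < w k) {T : Finset (Tile (m + 1))}
    (hT : IsTilingOffLeft θ (w * Equiv.swap k k') T) :
    IsTilingOffLeft θ w (insert (swapTile θ w h) T) := by
  have hU := polygon_eq_union hθ hk h
  -- A common interior point would have points of the swapped tile to its left, so it would lie
  -- outside the smaller polygon that contains `s`.
  have hd : ∀ s ∈ T,
      Disjoint (interior (s.region θ)) (interior ((swapTile θ w h).region θ)) := fun s hs => by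
    refine Set.disjoint_left.2 fun z h1 h2 => ?_
    have ht : Tendsto (fun ε : ℝ => z - ε) (𝓝[>] 0) (𝓝 z) := by
      have hc : Continuous fun ε : ℝ => z - ε := by fun_prop
      simpa using (hc.tendsto 0).mono_left (nhdsWithin_le_nhds (s := Ioi 0))
    obtain ⟨ε, h3, hε⟩ := ((ht.eventually (isOpen_interior.mem_nhds h2)).and
      self_mem_nhdsWithin).exists
    exact notMem_polygon_of_sub_mem hθ hk h hε (interior_subset h3)
      (hT.subset s hs (interior_subset h1))
  refine ⟨fun t ht => ?_, fun z hz hz1 => ?_, fun s hs t ht hne => ?_⟩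
  · rw [hU]
    rcases Finset.mem_insert.1 ht with rfl | ht
    · exact subset_union_right
    · exact (hT.subset t ht).trans subset_union_left
  · rw [hU] at hz
    rcases hz with hz | hz
    · obtain ⟨t, ht, hzt⟩ := hT.cover z hz hz1
      exact ⟨t, Finset.mem_insert_of_mem ht, hzt⟩
    · exact ⟨_, Finset.mem_insert_self _ _, hz⟩
  · rcases Finset.mem_insert.1 hs with rfl | hs
    · rcases Finset.mem_insert.1 ht with rfl | ht
      · exact absurd rfl hne
      · exact (hd t ht).symm
    · rcases Finset.mem_insert.1 ht with rfl | ht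
      · exact hd s hs
      · exact hT.disjoint s hs t ht hne

lemma IsTilingOffLeft.erase_swapTile [DecidableEq (Tile (m + 1))] (hθ : IsDirectionSystem θ)
    (hk : k'.val = k.val + 1) (h : w k' < w k) {T : Finset (Tile (m + 1))}
    (hT : IsTilingOffLeft θ w T) (ht : swapTile θ w h ∈ T) :
    IsTilingOffLeft θ (w * Equiv.swap k k') (T.erase (swapTile θ w h)) := by
  have hU := polygon_eq_union hθ hk h
  refine ⟨fun s hs => ?_, fun z hz hz1 => ?_, fun s hs t ht hne =>
    hT.disjoint s (Finset.mem_of_mem_erase hs) t (Finset.mem_of_mem_erase ht) hne⟩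
  · obtain ⟨hne, hs⟩ := Finset.mem_erase.1 hs
    -- Only interior points of `s` matter. One outside the smaller polygon would lie in the swapped
    -- tile but on neither path, hence in the interior of both tiles.
    refine (s.region_subset_closure_interior hθ).trans
      (closure_minimal (fun z hz => ?_) (isClosed_polygon hθ _))
    by_contra hz'
    have hzw := hT.subset s hs (interior_subset hz)
    rw [hU] at hzw
    have hzt := hzw.resolve_left hz'
    have hz1 : z ∉ path θ w := fun hzp => by
      have ht : Tendsto (fun ε : ℝ => z + ε) (𝓝[>] 0) (𝓝 z) := by
        have hc : Continuous fun ε : ℝ => z + ε := by fun_prop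
        simpa using (hc.tendsto 0).mono_left (nhdsWithin_le_nhds (s := Ioi 0))
      obtain ⟨ε, h3, hε⟩ := ((ht.eventually (isOpen_interior.mem_nhds hz)).and
        self_mem_nhdsWithin).exists
      obtain ⟨-, b, hb, hq⟩ := (mem_polygon_iff _ _).1 (hT.subset s hs (interior_subset h3))
      have := path_unique hθ hzp (r := ε + b) (by rw [add_assoc] at hq; exact_mod_cast hq)
      have hε : 0 < ε := hε
      linarith
    have hz2 : z ∉ path θ (w * Equiv.swap k k') := fun hzp => hz' (path_subset_polygon hθ _ hzp)
    obtain ⟨a, ha, b, hb, e⟩ := hzt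
    change z = (swapTile θ w h).point θ a b at e
    subst e
    refine Set.disjoint_left.1 (hT.disjoint s hs _ ht hne) hz (Tile.point_mem_interior hθ _
      ⟨lt_of_le_of_ne ha.1 ?_, lt_of_le_of_ne ha.2 ?_⟩
      ⟨lt_of_le_of_ne hb.1 ?_, lt_of_le_of_ne hb.2 ?_⟩)
    · rintro rfl; exact hz1 (swapTile_point_zero_mem h hb)
    · rintro rfl; exact hz2 (swapTile_point_mem_swap_one hk h hb)
    · rintro rfl; exact hz2 (swapTile_point_mem_swap_zero hk h ha)
    · rintro rfl; exact hz1 (swapTile_point_one_mem hk h ha)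
  · obtain ⟨⟨a, ha0, hp⟩, b, hb, hq⟩ := (mem_polygon_iff _ z).1 hz
    have ha : 0 < a := by
      refine lt_of_le_of_ne ha0 fun e => hz1 ?_
      simpa [← e] using hp
    have ht' : Tendsto (fun ε : ℝ => z - ε) (𝓝[>] 0) (𝓝 z) := by
      have hc : Continuous fun ε : ℝ => z - ε := by fun_prop
      simpa using (hc.tendsto 0).mono_left (nhdsWithin_le_nhds (s := Ioi 0))
    -- Points slightly to the left of `z` remain in the smaller polygon and are covered. The swapped
    -- tile cannot cover them, since `z` would then lie to its right, outside the smaller polygon.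
    have : z ∈ ⋃ t ∈ T.erase (swapTile θ w h), t.region θ := by
      refine (isClosed_biUnion_region hθ _).mem_of_tendsto ht' ?_
      filter_upwards [Ioo_mem_nhdsGT ha] with ε hε
      have h1 : z - ε ∈ polygon θ (w * Equiv.swap k k') := (mem_polygon_iff _ _).2
        ⟨⟨a - ε, by linarith [hε.2], by convert hp using 1; push_cast; ring⟩,
          b + ε, by linarith [hε.1], by convert hq using 1; push_cast; ring⟩
      obtain ⟨s, hs, hzs⟩ := hT.cover (z - ε) (by rw [hU]; exact .inl h1) fun h' => by
        have := path_unique hθ hp (r := a - ε) (by convert h' using 1; push_cast; ring)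
        linarith [hε.2]
      simp only [mem_iUnion]
      refine ⟨s, Finset.mem_erase.2 ⟨?_, hs⟩, hzs⟩
      rintro rfl
      exact notMem_polygon_of_sub_mem hθ hk h hε.1 hzs hz
    simpa only [mem_iUnion, exists_prop] using this

end Tilings

end Elnitsky

namespace Elnitsky

open Set Filter Topology

/-! ### Every tiling of a nontrivial polygon has a tile that can be peeled off on the right. -/

section Peeling

variable {m : ℕ} {θ : Fin (m + 1) → ℝ} {w : Equiv.Perm (Fin (m + 1))}

lemma Tile.eq_of_fields {n : ℕ} {s t : Tile n} (h1 : s.top = t.top) (h2 : s.lo = t.lo)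
    (h3 : s.hi = t.hi) : s = t := by
  cases s; cases t; simp_all

/-- If points of a ray arbitrarily close to its origin lie on a unit segment, then the segment has
the direction of the ray and contains its origin, but not as its lower end. -/
lemma exists_eq_add_of_frequently {n : ℕ} {θ : Fin n → ℝ} (hθ : IsDirectionSystem θ) {p c : ℂ}
    {i j : Fin n}
    (h : ∃ᶠ δ : ℝ in 𝓝[>] 0, ∃ b ∈ Icc (0 : ℝ) 1, p + δ * dir θ i = c + b * dir θ j) :
    j = i ∧ ∃ b ∈ Ico (0 : ℝ) 1, p = c + b * dir θ j := by
  obtain ⟨δ₁, ⟨b₁, hb₁, e₁⟩, h₁⟩ := (h.and_eventually self_mem_nhdsWithin).exists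
  have h₁ : 0 < δ₁ := h₁
  have step : ∀ δ b : ℝ, δ ≠ δ₁ → p + δ * dir θ i = c + b * dir θ j →
      j = i ∧ b - δ = b₁ - δ₁ := fun δ b hne e => by
    have key : ((δ - δ₁ : ℝ) : ℂ) * dir θ i = ((b - b₁ : ℝ) : ℂ) * dir θ j := by
      push_cast
      linear_combination e - e₁
    have hij := eq_of_mul_dir_eq hθ (sub_ne_zero.2 hne) key
    subst hij
    refine ⟨rfl, ?_⟩
    have := mul_right_cancel₀ (dir_ne_zero hθ _) key
    have : δ - δ₁ = b - b₁ := by exact_mod_cast this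
    linarith
  have hji : j = i := by
    obtain ⟨δ, ⟨b, -, e⟩, hδ⟩ := (h.and_eventually (Ioo_mem_nhdsGT h₁)).exists
    exact (step δ b hδ.2.ne e).1
  refine ⟨hji, b₁ - δ₁, ⟨?_, by linarith [hb₁.2]⟩, ?_⟩
  -- On the segment the coordinate is `δ + (b₁ - δ₁)`; were the offset negative, it would be
  -- negative for small `δ`.
  · by_contra hneg
    push Not at hneg
    obtain ⟨δ, ⟨b, hb, e⟩, hδ⟩ := (h.and_eventually
      (Ioo_mem_nhdsGT (lt_min h₁ (neg_pos.2 hneg)))).exists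
    have := (step δ b (hδ.2.trans_le (min_le_left _ _)).ne e).2
    have := hδ.2.trans_le (min_le_right _ _)
    linarith [hb.1]
  · subst hji
    push_cast
    linear_combination e₁

/-- The tile just below a point of the rightside boundary. -/
lemma IsTilingOffLeft.exists_tile_below (hθ : IsDirectionSystem θ) {T : Finset (Tile (m + 1))}
    (hT : IsTilingOffLeft θ w T) (j : Fin (m + 1)) {s : ℝ} (hs : s ∈ Ico (0 : ℝ) 1)
    (hl : ∀ᶠ δ : ℝ in 𝓝[>] 0,
      pathVertex θ w j + (s : ℂ) * dir θ (w j) + δ * dir θ (w j) ∉ path θ 1) :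
    ∃ t ∈ T,
      (t.hi = w j ∧ ∃ b ∈ Ico (0 : ℝ) 1,
        pathVertex θ w j + (s : ℂ) * dir θ (w j) = t.point θ 0 b) ∨
      (t.lo = w j ∧ ∃ a ∈ Ico (0 : ℝ) 1,
        pathVertex θ w j + (s : ℂ) * dir θ (w j) = t.point θ a 1) := by
  set p := pathVertex θ w j + (s : ℂ) * dir θ (w j) with hp
  have hev : ∀ᶠ δ : ℝ in 𝓝[>] 0, ∃ t ∈ T,
      (∃ b ∈ Icc (0 : ℝ) 1, p + δ * dir θ (w j) = t.top + b * dir θ t.hi) ∨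
      ∃ a ∈ Icc (0 : ℝ) 1, p + δ * dir θ (w j) = t.top + dir θ t.hi + a * dir θ t.lo := by
    filter_upwards [hl, Ioo_mem_nhdsGT (sub_pos.2 hs.2)] with δ hδ hδ'
    have hmem : p + δ * dir θ (w j) ∈ path θ w :=
      (mem_path_iff _ _).2 ⟨j, s + δ, ⟨by linarith [hs.1, hδ'.1], by linarith [hδ'.2]⟩, by
        rw [hp]; push_cast; ring⟩
    obtain ⟨t, ht, a, ha, b, hb, e⟩ := hT.cover _ (path_subset_polygon hθ w hmem) hδ
    refine ⟨t, ht, ?_⟩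
    change _ = t.point θ a b at e
    by_cases ha0 : a = 0
    · exact .inl ⟨b, hb, by rw [e, ha0]; simp [Tile.point]⟩
    by_cases hb1 : b = 1
    · exact .inr ⟨a, ha, by rw [e, hb1]; simp only [Tile.point, Complex.ofReal_one]; ring⟩
    rw [e] at hmem
    exact absurd hmem (t.point_notMem_right hθ (hT.subset t ht)
      ⟨lt_of_le_of_ne ha.1 (Ne.symm ha0), ha.2⟩ ⟨hb.1, lt_of_le_of_ne hb.2 hb1⟩)
  -- Pigeonhole: there are finitely many tiles, so one of them serves arbitrarily small `δ`.
  have hfr : ∃ t ∈ T, ∃ᶠ δ : ℝ in 𝓝[>] 0,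
      (∃ b ∈ Icc (0 : ℝ) 1, p + δ * dir θ (w j) = t.top + b * dir θ t.hi) ∨
      ∃ a ∈ Icc (0 : ℝ) 1, p + δ * dir θ (w j) = t.top + dir θ t.hi + a * dir θ t.lo := by
    by_contra hcon
    have hcon := fun t ht h => hcon ⟨t, ht, h⟩
    have : ∀ᶠ δ : ℝ in 𝓝[>] 0, ∀ t ∈ T, ¬
        ((∃ b ∈ Icc (0 : ℝ) 1, p + δ * dir θ (w j) = t.top + b * dir θ t.hi) ∨
        ∃ a ∈ Icc (0 : ℝ) 1, p + δ * dir θ (w j) = t.top + dir θ t.hi + a * dir θ t.lo) :=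
      (Filter.eventually_all_finset T).2 fun t ht =>
        Filter.not_frequently.1 (hcon t ht)
    obtain ⟨δ, ⟨t, ht, h⟩, h'⟩ := (hev.and this).exists
    exact h' t ht h
  obtain ⟨t, ht, h⟩ := hfr
  refine ⟨t, ht, (Filter.frequently_or_distrib.1 h).imp (fun h => ?_) fun h => ?_⟩
  · obtain ⟨h1, b, hb, e⟩ := exists_eq_add_of_frequently hθ h
    exact ⟨h1, b, hb, by rw [e]; simp [Tile.point]⟩
  · obtain ⟨h1, a, ha, e⟩ := exists_eq_add_of_frequently hθ h
    exact ⟨h1, a, ha, by rw [e]; simp only [Tile.point, Complex.ofReal_one]; ring⟩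

lemma eventually_notMem_path_one {p v : ℂ} (hp : p ∉ path θ 1) :
    ∀ᶠ δ : ℝ in 𝓝[>] 0, p + δ * v ∉ path θ 1 := by
  have hc : Continuous fun δ : ℝ => p + δ * v := by fun_prop
  have ht := (hc.tendsto 0).mono_left (nhdsWithin_le_nhds (s := Ioi 0))
  rw [Complex.ofReal_zero, zero_mul, add_zero] at ht
  exact ht.eventually ((isCompact_path 1).isClosed.isOpen_compl.mem_nhds hp)

/-- Some tile has its upper right edge partly on the rightside boundary. -/
lemma IsTilingOffLeft.exists_upper_tile (hθ : IsDirectionSystem θ) {T : Finset (Tile (m + 1))}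
    (hT : IsTilingOffLeft θ w T) (hw : w ≠ 1) :
    ∃ t ∈ T, ∃ r ∈ Ioo (-1 : ℝ) 1, t.top = pathVertex θ w (w.symm t.hi) + r * dir θ t.hi := by
  have hne : (Finset.univ.filter fun i => w i ≠ i).Nonempty := by
    by_contra h
    rw [Finset.not_nonempty_iff_eq_empty, Finset.filter_eq_empty_iff] at h
    exact hw (Equiv.ext fun i => not_not.1 (h (Finset.mem_univ i)))
  -- At the smallest moved position the rightside boundary leaves the leftside boundary for the
  -- first time.
  obtain ⟨k, hk, hmin⟩ := Finset.exists_min_image _ id hne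
  have hk : w k ≠ k := by simpa using hk
  have hmin : ∀ i, i < k → w i = i := fun i hi => by
    by_contra h
    exact (hmin i (by simpa using h)).not_gt hi
  have hv : pathVertex θ w k = pathVertex θ 1 k := Finset.sum_congr rfl fun i hi => by
    rw [hmin i (by simpa using hi)]; rfl
  have hl : ∀ᶠ δ : ℝ in 𝓝[>] 0,
      pathVertex θ w k + ((0 : ℝ) : ℂ) * dir θ (w k) + δ * dir θ (w k) ∉ path θ 1 := by
    filter_upwards [Ioo_mem_nhdsGT one_pos] with δ hδ h
    have hδ' : δ ∈ Icc (0 : ℝ) 1 := Ioo_subset_Icc_self hδ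
    rw [Complex.ofReal_zero, zero_mul, add_zero, ← pathPoint_add w k hδ'] at h
    have := ramp_symm_eq hθ (add_mem_Icc k hδ') h k
    rw [ramp_add k hδ', ramp_add k hδ', if_neg (lt_irrefl k), if_pos rfl] at this
    split_ifs at this
    · exact hδ.2.ne this
    · exact hδ.1.ne' this
  obtain ⟨t, ht, ⟨h1, b, hb, e⟩ | ⟨h1, a, ha, e⟩⟩ :=
    hT.exists_tile_below hθ k ⟨le_rfl, one_pos⟩ hl
  · refine ⟨t, ht, -b, ⟨by linarith [hb.2], by linarith [hb.1]⟩, ?_⟩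
    rw [h1, Equiv.symm_apply_apply]
    simp only [Tile.point, h1, Complex.ofReal_zero, zero_mul, add_zero] at e
    rw [e]; push_cast; ring
  -- A tile touching this vertex by its lower right edge would have interior points to the left of
  -- the leftside boundary.
  · refine absurd ?_ (t.point_notMem_left hθ (hT.subset t ht) ha ⟨one_pos, le_rfl⟩)
    rw [← e, Complex.ofReal_zero, zero_mul, add_zero, hv]
    exact pathVertex_mem_path 1 k

/-- Some tile has two consecutive sides of the rightside boundary as its right edges. -/
lemma IsTilingOffLeft.exists_swapTile_mem (hθ : IsDirectionSystem θ) {T : Finset (Tile (m + 1))}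
    (hT : IsTilingOffLeft θ w T) (hw : w ≠ 1) :
    ∃ k k' : Fin (m + 1), k'.val = k.val + 1 ∧ ∃ h : w k' < w k, swapTile θ w h ∈ T := by
  classical
  set U := T.filter fun t => ∃ r ∈ Ioo (-1 : ℝ) 1,
    t.top = pathVertex θ w (w.symm t.hi) + r * dir θ t.hi with hU
  have hUne : U.Nonempty := by
    obtain ⟨t, ht, h⟩ := hT.exists_upper_tile hθ hw
    exact ⟨t, Finset.mem_filter.2 ⟨ht, h⟩⟩
  obtain ⟨t, htU, hmax⟩ := Finset.exists_max_image U
    -- Among tiles whose upper right edge overlaps the right side of the same label, take the lowest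
    -- side and then the lowest tile. The offset `r` says how far the edge starts below the top of
    -- that side.
    (fun t => toLex (w.symm t.hi, -t.top.im)) hUne
  obtain ⟨ht, r, hr, htop⟩ := Finset.mem_filter.1 htU
  have hmax1 : ∀ s ∈ T, ∀ r' ∈ Ioo (-1 : ℝ) 1,
      s.top = pathVertex θ w (w.symm s.hi) + r' * dir θ s.hi →
      w.symm s.hi ≤ w.symm t.hi ∧ (s.hi = t.hi → t.top.im ≤ s.top.im) := fun s hs r' hr' e => by
    have := Prod.Lex.toLex_le_toLex.1 (hmax s (Finset.mem_filter.2 ⟨hs, r', hr', e⟩))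
    simp only [neg_le_neg_iff] at this
    rcases this with h | ⟨h, h'⟩
    · refine ⟨h.le, fun e => ?_⟩
      rw [e] at h
      exact absurd h (lt_irrefl _)
    · exact ⟨h.le, fun _ => h'⟩
  obtain ⟨k, hk⟩ : ∃ k, w k = t.hi := ⟨w.symm t.hi, by simp⟩
  rw [← hk, Equiv.symm_apply_apply] at htop hmax1
  -- If `r < 0`, the edge ends inside the side, and the tile just below its end either is a lower
  -- tile on the same side or equals `t` with both labels the same. If `r ≥ 0`, the edge reaches the
  -- end of the side, where the next side takes over.
  rcases lt_or_ge r 0 with hr0 | hr0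
  · exfalso
    have hp : pathVertex θ w k + ((1 + r : ℝ) : ℂ) * dir θ (w k) = t.point θ 0 1 := by
      simp only [Tile.point, htop, hk]; push_cast; ring
    have hpl : t.point θ 0 1 ∉ path θ 1 := t.point_notMem_left hθ (hT.subset t ht)
      ⟨le_rfl, one_pos⟩ ⟨one_pos, le_rfl⟩
    obtain ⟨s, hs, ⟨h1, b, hb, e⟩ | ⟨h1, a, ha, e⟩⟩ :=
      hT.exists_tile_below hθ k (s := 1 + r) ⟨by linarith [hr.1], by linarith⟩
        (eventually_notMem_path_one (hp ▸ hpl))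
    · have e' : s.top = pathVertex θ w k + ((1 + r - b : ℝ) : ℂ) * dir θ (w k) := by
        simp only [Tile.point, h1, Complex.ofReal_zero, zero_mul, add_zero] at e
        push_cast at e ⊢
        linear_combination -e
      have hle := (hmax1 s hs (1 + r - b) ⟨by linarith [hr.1, hb.2], by linarith [hb.1]⟩
        (by rw [h1, Equiv.symm_apply_apply]; exact e')).2 h1
      rw [e', htop] at hle
      simp only [Complex.add_im, Complex.im_ofReal_mul, add_le_add_iff_left] at hle
      have := (mul_le_mul_right_of_neg (dir_im_neg hθ (w k))).1 hle
      linarith [hb.2]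
    · have := hT.eq_of_point_eq hθ ht hs ⟨le_rfl, one_pos⟩ ⟨one_pos, le_rfl⟩ ha
        ⟨one_pos, le_rfl⟩ (hp.symm.trans e)
      rw [← this, hk] at h1
      exact t.lo_lt_hi.ne h1
  · have hp : pathVertex θ w ((k : ℕ) + 1) = t.point θ 0 (1 - r) := by
      rw [pathVertex_succ]
      simp only [Tile.point, htop, hk]; push_cast; ring
    have hr1 : 1 - r ∈ Ioc (0 : ℝ) 1 := ⟨by linarith [hr.2], by linarith⟩
    have hpl : t.point θ 0 (1 - r) ∉ path θ 1 := t.point_notMem_left hθ (hT.subset t ht)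
      ⟨le_rfl, one_pos⟩ hr1
    have hkm : k.val + 1 < m + 1 := by
      refine lt_of_le_of_ne k.2 fun e => hpl ?_
      rw [← hp, e, pathVertex_top]
      exact pathVertex_succ_mem_path 1 (Fin.last m)
    obtain ⟨k', hk'⟩ : ∃ k' : Fin (m + 1), k'.val = k.val + 1 := ⟨⟨_, hkm⟩, rfl⟩
    have hp' : pathVertex θ w k' + ((0 : ℝ) : ℂ) * dir θ (w k') = t.point θ 0 (1 - r) := by
      rw [hk', hp]; simp
    obtain ⟨s, hs, ⟨h1, b, hb, e⟩ | ⟨h1, a, ha, e⟩⟩ :=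
      hT.exists_tile_below hθ k' (s := 0) ⟨le_rfl, one_pos⟩
        (eventually_notMem_path_one (hp' ▸ hpl))
    · exfalso
      have hle := (hmax1 s hs (-b) ⟨by linarith [hb.2], by linarith [hb.1]⟩ (by
        rw [h1, Equiv.symm_apply_apply]
        simp only [Tile.point, h1, Complex.ofReal_zero, zero_mul, add_zero] at e
        rw [e]; push_cast; ring)).1
      rw [h1, Equiv.symm_apply_apply, Fin.le_def] at hle
      omega
    -- Both tiles have interior just to the left of this vertex, so they coincide; uniqueness of
    -- coordinates then forces `r = 0`.
    · have hts := hT.eq_of_point_eq hθ ht hs ⟨le_rfl, one_pos⟩ hr1 ha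
        ⟨one_pos, le_rfl⟩ (hp'.symm.trans e)
      rw [← hts] at h1 e
      obtain ⟨-, h2⟩ := t.point_inj hθ (hp'.symm.trans e)
      have hr00 : r = 0 := by linarith
      refine ⟨k, k', hk', by rw [← h1, hk]; exact t.lo_lt_hi, ?_⟩
      convert ht using 1
      refine Tile.eq_of_fields ?_ h1.symm hk
      rw [htop, hr00]
      simp [swapTile]

end Peeling

/-! ### Tilings built or dismantled along descents, and their bottom tile. -/

section Existence

variable {m : ℕ} {θ : Fin (m + 1) → ℝ}

/-- The polygon of the identity is the leftside boundary itself, so nothing is left to cover: this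
starts the construction of tilings. -/
lemma isTilingOffLeft_one (hθ : IsDirectionSystem θ) : IsTilingOffLeft θ 1 ∅ where
  subset := by simp
  cover z hz hz1 := by
    obtain ⟨⟨a, ha, hp⟩, b, hb, hq⟩ := (mem_polygon_iff _ z).1 hz
    have := path_unique hθ hp (r := a + b) (by convert hq using 1; push_cast; ring)
    have ha0 : a = 0 := by linarith
    exact absurd (by simpa [ha0] using hp) hz1
  disjoint := by simp

lemma exists_descent {w : Equiv.Perm (Fin (m + 1))} (hw : w ≠ 1) :
    ∃ k k' : Fin (m + 1), k'.val = k.val + 1 ∧ w k' < w k := by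
  by_contra! h
  refine hw (Equiv.ext fun i => ?_)
  have hmono : StrictMono w := Fin.strictMono_iff_lt_succ.2 fun i =>
    lt_of_le_of_ne (h i.castSucc i.succ (by simp)) fun e =>
      (Fin.castSucc_lt_succ (i := i)).ne (w.injective e)
  exact congrFun ((hmono.range_inj strictMono_id).1 (by simp [w.surjective.range_eq])) i

lemma exists_isTilingOffLeft (hθ : IsDirectionSystem θ) (w : Equiv.Perm (Fin (m + 1))) :
    ∃ T, IsTilingOffLeft θ w T := by
  classical
  -- Exchanging a descent makes the word of `w` lexicographically smaller.
  induction h : toLex (⇑w) using WellFoundedLT.induction generalizing w with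
  | ind f ih =>
    by_cases hw : w = 1
    · exact ⟨∅, hw ▸ isTilingOffLeft_one hθ⟩
    obtain ⟨k, k', hk, hlt⟩ := exists_descent hw
    obtain ⟨T, hT⟩ := ih (toLex (⇑(w * Equiv.swap k k'))) (by
      rw [← h]
      refine ⟨k, fun j hj => ?_, ?_⟩
      · change w (Equiv.swap k k' j) = w j
        rw [Equiv.swap_apply_of_ne_of_ne hj.ne fun e => by
          rw [e, Fin.lt_def] at hj; omega]
      · change w (Equiv.swap k k' k) < w k
        rwa [Equiv.swap_apply_left]) _ rfl
    exact ⟨_, hT.insert_swapTile hθ hk hlt⟩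

lemma swapTile_point_one_one {w : Equiv.Perm (Fin (m + 1))} {k : Fin (m + 1)}
    (hk : m = k.val + 1) (h : w (Fin.last m) < w k) :
    (swapTile θ w h).point θ 1 1 = pathVertex θ 1 (m + 1) := by
  have h1 := pathVertex_succ (θ := θ) w (Fin.last m)
  have h2 := pathVertex_succ (θ := θ) w k
  rw [← hk] at h2
  rw [Fin.val_last] at h1
  rw [← pathVertex_top w, h1, h2]
  simp only [Tile.point, swapTile, Complex.ofReal_one]
  ring

/-- The last value and the nearest larger value to its left label the bottom tile of some tiling. -/
lemma exists_isTilingOffLeft_bottom (hθ : IsDirectionSystem θ) (d : ℕ)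
    (w : Equiv.Perm (Fin (m + 1))) (j : Fin (m + 1)) (hj : j.val + 1 + d = m)
    (hlt : w (Fin.last m) < w j)
    (hsmall : ∀ i, j < i → i < Fin.last m → w i < w (Fin.last m)) :
    ∃ T, IsTilingOffLeft θ w T ∧ ∃ t ∈ T, t.lo = w (Fin.last m) ∧ t.hi = w j ∧
      t.point θ 1 1 = pathVertex θ 1 (m + 1) := by
  classical
  induction d generalizing w j with
  | zero =>
    obtain ⟨T, hT⟩ := exists_isTilingOffLeft hθ (w * Equiv.swap j (Fin.last m))
    exact ⟨_, hT.insert_swapTile hθ (by simpa using hj.symm) hlt, _,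
      Finset.mem_insert_self _ _, rfl, rfl, swapTile_point_one_one (by omega) hlt⟩
  | succ d ih =>
    obtain ⟨k', hk'⟩ : ∃ k' : Fin (m + 1), k'.val = j.val + 1 := ⟨⟨j.val + 1, by omega⟩, rfl⟩
    have hk'l : k' < Fin.last m := by rw [Fin.lt_def, Fin.val_last]; omega
    have hjk : j < k' := by rw [Fin.lt_def]; omega
    have hlast : (w * Equiv.swap j k') (Fin.last m) = w (Fin.last m) := by
      rw [Equiv.Perm.mul_apply, Equiv.swap_apply_of_ne_of_ne (hjk.trans hk'l).ne' hk'l.ne']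
    have hk'j : (w * Equiv.swap j k') k' = w j := by
      rw [Equiv.Perm.mul_apply, Equiv.swap_apply_right]
    -- `d` counts the entries between `j` and the last position. All are below `w(n) < w j`, so
    -- moving `w j` one step right exchanges a descent.
    obtain ⟨T, hT, t, ht, h1, h2, h3⟩ := ih (w * Equiv.swap j k') k' (by omega)
      (by rwa [hlast, hk'j]) fun i hi hil => by
        rw [hlast, Equiv.Perm.mul_apply, Equiv.swap_apply_of_ne_of_ne (hjk.trans hi).ne' hi.ne']
        exact hsmall i (hjk.trans hi) hil
    exact ⟨_, hT.insert_swapTile hθ hk' ((hsmall k' hjk hk'l).trans hlt), t,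
      Finset.mem_insert_of_mem ht, h1.trans hlast, h2.trans hk'j, h3⟩

/-- If the largest value follows all other values larger than the last one, then it labels the
bottom tile of every tiling together with the last value. -/
lemma IsTilingOffLeft.exists_bottom (hθ : IsDirectionSystem θ) (T : Finset (Tile (m + 1)))
    (w : Equiv.Perm (Fin (m + 1))) (hT : IsTilingOffLeft θ w T)
    (hne : w (Fin.last m) ≠ Fin.last m)
    (hw : ∀ y, w (Fin.last m) < y → y < Fin.last m → w.symm y < w.symm (Fin.last m)) :
    ∃ t ∈ T, t.lo = w (Fin.last m) ∧ t.hi = Fin.last m ∧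
      t.point θ 1 1 = pathVertex θ 1 (m + 1) := by
  classical
  induction hN : T.card using Nat.strong_induction_on generalizing T w with
  | _ N ih =>
    obtain ⟨k, k', hk, hlt, ht⟩ := hT.exists_swapTile_mem hθ fun h => hne (by rw [h]; rfl)
    by_cases hlast : k' = Fin.last m
    · subst hlast
      refine ⟨_, ht, rfl, ?_, swapTile_point_one_one (by simpa using hk) hlt⟩
      by_contra hkn
      change w k ≠ _ at hkn
      -- Otherwise `w k`, in the last position but one, would precede the largest value, which would
      -- then have to be last.
      have := hw (w k) hlt (lt_of_le_of_ne (Fin.le_last _) hkn)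
      rw [Equiv.symm_apply_apply, Fin.lt_def] at this
      have h2 : w.symm (Fin.last m) ≠ Fin.last m := fun e => hne (by
        conv_lhs => rw [← e]
        simp)
      have h3 : (w.symm (Fin.last m)).val ≠ m := fun e => h2 (Fin.ext e)
      have h4 := (w.symm (Fin.last m)).is_le
      rw [Fin.val_last] at hk
      omega
    · have hk'l : k'.val ≠ m := fun e => hlast (Fin.ext e)
      have hkl : k ≠ Fin.last m := fun e => by
        have := k'.is_le
        rw [e, Fin.val_last] at hk
        omega
      have hlast' : (w * Equiv.swap k k') (Fin.last m) = w (Fin.last m) := by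
        rw [Equiv.Perm.mul_apply, Equiv.swap_apply_of_ne_of_ne hkl.symm (Ne.symm hlast)]
      obtain ⟨t, htT, h⟩ := ih _ (by rw [← hN]; exact Finset.card_erase_lt_of_mem ht) _
        (w * Equiv.swap k k') (hT.erase_swapTile hθ hk hlt ht) (by rwa [hlast'])
        (fun y h1 h2 => by
          rw [hlast'] at h1
          have h3 := hw y h1 h2
          change Equiv.swap k k' (w.symm y) < Equiv.swap k k' (w.symm (Fin.last m))
          -- The exchange reverses the order of a single pair, the descent; `y` followed by the
          -- larger `n` is not one.
          have h4 : w.symm y = k → w.symm (Fin.last m) ≠ k' := fun e1 e2 => by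
            rw [← e1, ← e2, Equiv.apply_symm_apply, Equiv.apply_symm_apply] at hlt
            exact absurd hlt h2.not_gt
          rw [Equiv.swap_apply_def, Equiv.swap_apply_def]
          simp only [Fin.lt_def, Fin.ext_iff] at h3 h4 ⊢
          split_ifs <;> simp_all <;> omega) rfl
      rw [hlast'] at h
      exact ⟨t, Finset.mem_of_mem_erase htT, h⟩

end Existence

/-! ### Bottom-perimeter tiles recognised by labels and lowest vertex. -/

section BottomTiles

variable {m : ℕ} {θ : Fin (m + 1) → ℝ} {w : Equiv.Perm (Fin (m + 1))}

/-- Segments that point downwards determine their upper ends and directions. -/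
lemma eq_of_segment_eq {x y u v : ℂ} (hu : u.im < 0) (hv : v.im < 0)
    (h : segment ℝ x (x + u) = segment ℝ y (y + v)) : x = y ∧ u = v := by
  have aux : ∀ x u : ℂ, segment ℝ x (x + u) = (fun s : ℝ => x + s * u) '' Icc 0 1 := fun x u => by
    rw [segment_eq_image']; simp
  have hx : x ∈ segment ℝ y (y + v) := h ▸ left_mem_segment ℝ x _
  have hy : y ∈ segment ℝ x (x + u) := h ▸ left_mem_segment ℝ y _
  have hxu : x + u ∈ segment ℝ y (y + v) := h ▸ right_mem_segment ℝ x _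
  have hyv : y + v ∈ segment ℝ x (x + u) := h ▸ right_mem_segment ℝ y _
  rw [aux] at hx hy hxu hyv
  obtain ⟨s, hs, e1⟩ := hx
  obtain ⟨s', hs', e2⟩ := hy
  have i1 : y.im + s * v.im = x.im := by simpa using congrArg Complex.im e1
  have i2 : x.im + s' * u.im = y.im := by simpa using congrArg Complex.im e2
  have p1 := mul_nonpos_of_nonneg_of_nonpos hs.1 hv.le
  have p2 := mul_nonpos_of_nonneg_of_nonpos hs'.1 hu.le
  have hs0 : s = 0 := (mul_eq_zero.1 (show s * v.im = 0 by linarith)).resolve_right hv.ne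
  have hxy : x = y := by simpa [hs0] using e1.symm
  subst hxy
  refine ⟨rfl, ?_⟩
  obtain ⟨c, hc, e3⟩ := hxu
  obtain ⟨c', hc', e4⟩ := hyv
  have e3 : (c : ℂ) * v = u := add_left_cancel e3
  have e4 : (c' : ℂ) * u = v := add_left_cancel e4
  have i3 : c * v.im = u.im := by simpa using congrArg Complex.im e3
  have i4 : c' * u.im = v.im := by simpa using congrArg Complex.im e4
  have hc1 : c = 1 := by
    refine le_antisymm hc.2 ?_
    by_contra hlt
    push Not at hlt
    have h1 : v.im < c * v.im := by nlinarith
    have h2 : u.im ≤ c' * u.im := by nlinarith [hc'.2]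
    linarith
  simpa [hc1] using e3.symm

lemma sides_bottom_eq (w : Equiv.Perm (Fin (m + 1))) :
    pathSide θ w (Fin.last m) = segment ℝ (pathVertex θ w m)
      (pathVertex θ w m + dir θ (w (Fin.last m))) ∧
    pathVertex θ w m + dir θ (w (Fin.last m)) = pathVertex θ 1 (m + 1) := by
  have h := pathVertex_succ (θ := θ) w (Fin.last m)
  rw [Fin.val_last] at h
  exact ⟨by rw [pathSide, Fin.val_last, h], by rw [← h, pathVertex_top]⟩

lemma IsBottomPerimeterTile.labels_and_bottom (hθ : IsDirectionSystem θ)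
    (hne : w (Fin.last m) ≠ Fin.last m) {t : Tile (m + 1)} (h : IsBottomPerimeterTile θ w t) :
    t.lo = w (Fin.last m) ∧ t.hi = Fin.last m ∧ t.point θ 1 1 = pathVertex θ 1 (m + 1) := by
  have edge : ∀ w : Equiv.Perm (Fin (m + 1)), pathSide θ w (Fin.last m) ∈ t.edges θ →
      (t.lo = w (Fin.last m) ∧ (t.top + dir θ t.lo = pathVertex θ 1 (m + 1) ∨
        t.point θ 1 1 = pathVertex θ 1 (m + 1))) ∨
      (t.hi = w (Fin.last m) ∧ (t.top + dir θ t.hi = pathVertex θ 1 (m + 1) ∨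
        t.point θ 1 1 = pathVertex θ 1 (m + 1))) := fun w hw => by
    obtain ⟨e1, e2⟩ := sides_bottom_eq (θ := θ) w
    have hpt : t.point θ 1 1 = t.top + dir θ t.lo + dir θ t.hi := by simp [Tile.point]
    rw [e1] at hw
    have seg : ∀ {x : ℂ} {i : Fin (m + 1)},
        segment ℝ (pathVertex θ w m) (pathVertex θ w m + dir θ (w (Fin.last m))) =
          segment ℝ x (x + dir θ i) →
        i = w (Fin.last m) ∧ x + dir θ i = pathVertex θ 1 (m + 1) := fun h => by
      obtain ⟨h1, h2⟩ := eq_of_segment_eq (dir_im_neg hθ _) (dir_im_neg hθ _) h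
      exact ⟨(dir_injective hθ h2).symm, by rw [← h1, ← h2, e2]⟩
    rcases hw with hw | hw | hw | hw
    · exact .inl ⟨(seg hw).1, .inl (seg hw).2⟩
    · exact .inr ⟨(seg hw).1, .inl (seg hw).2⟩
    · exact .inr ⟨(seg hw).1, .inr (hpt.trans (seg hw).2)⟩
    · rw [add_right_comm] at hw hpt
      exact .inl ⟨(seg hw).1, .inr (hpt.trans (seg hw).2)⟩
  have hl := edge 1 h.1
  have hr := edge w h.2
  rw [Equiv.Perm.one_apply] at hl
  have hhi : t.hi = Fin.last m := hl.elim
    (fun h => absurd (t.lo_lt_hi.trans_le (Fin.le_last _)) (by rw [h.1]; exact lt_irrefl _))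
    (fun h => h.1)
  have hlo : t.lo = w (Fin.last m) := hr.elim (fun h => h.1)
    fun h => absurd (h.1.symm.trans hhi) hne
  refine ⟨hlo, hhi, ?_⟩
  -- The bottom vertex of the polygon must be that of the tile: two upper edges of a tile cannot end
  -- at the same point.
  rcases hl with ⟨h1, -⟩ | ⟨-, h1 | h1⟩
  · exact absurd (h1.trans hhi.symm) t.lo_lt_hi.ne
  · rcases hr with ⟨-, h2 | h2⟩ | ⟨h2, -⟩
    · exact absurd (dir_injective hθ (add_left_cancel (h2.trans h1.symm))) t.lo_lt_hi.ne
    · exact h2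
    · exact absurd (h2.symm.trans hhi) hne
  · exact h1

lemma isBottomPerimeterTile_of_labels {t : Tile (m + 1)} (h1 : t.lo = w (Fin.last m))
    (h2 : t.hi = Fin.last m) (h3 : t.point θ 1 1 = pathVertex θ 1 (m + 1)) :
    IsBottomPerimeterTile θ w t := by
  have hpt : t.point θ 1 1 = t.top + dir θ t.lo + dir θ t.hi := by simp [Tile.point]
  obtain ⟨e1, e2⟩ := sides_bottom_eq (θ := θ) 1
  obtain ⟨e3, e4⟩ := sides_bottom_eq (θ := θ) w
  rw [Equiv.Perm.one_apply, ← h2] at e1 e2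
  rw [← h1] at e3 e4
  rw [← h3, hpt] at e2 e4
  have e2' := add_right_cancel e2
  rw [add_right_comm] at e4
  have e4' := add_right_cancel e4
  constructor
  · change pathSide θ 1 (Fin.last m) ∈ t.edges θ
    rw [h2] at e1
    rw [e1, e2', ← h2]
    exact .inr (.inr (.inl rfl))
  · change pathSide θ w (Fin.last m) ∈ t.edges θ
    rw [e3, e4']
    refine .inr (.inr (.inr ?_))
    rw [mem_singleton_iff, add_right_comm]

end BottomTiles

/-! ### Translation of conditions (b) and (c) into the common criterion. -/

section Patterns

variable {m : ℕ} {w : Equiv.Perm (Fin (m + 1))}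

lemma FullySupported.last_ne (hm : 1 ≤ m) (hw : FullySupported w) :
    w (Fin.last m) ≠ Fin.last m := fun h => by
  have hS : {i : Fin (m + 1) | i.val < m} = {Fin.last m}ᶜ := by
    ext i
    simp only [mem_ofPred_eq, mem_compl_iff, mem_singleton_iff, Fin.ext_iff, Fin.val_last]
    have := i.is_le
    omega
  refine hw m hm (Nat.lt_succ_self m) ?_
  rw [hS, image_compl_eq w.bijective, image_singleton, h]

lemma symm_last_lt (hne : w (Fin.last m) ≠ Fin.last m) : w.symm (Fin.last m) < Fin.last m :=
  lt_of_le_of_ne (Fin.le_last _) fun e => hne (by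
    conv_lhs => rw [← e]
    simp)

/-- In such a pattern the largest value can only come first and the last position only third, so
just the middle entry is free. -/
lemma togetherIn321_iff (hne : w (Fin.last m) ≠ Fin.last m) :
    TogetherIn321 w (w (Fin.last m)) (Fin.last m) ↔
      ∃ j, w.symm (Fin.last m) < j ∧ j < Fin.last m ∧ w (Fin.last m) < w j := by
  constructor
  · rintro ⟨i, j, k, hij, hjk, hkj, hji, hc, hn⟩
    have hi : w i = Fin.last m := by
      rcases hn with h | h | h
      · exact h.symm
      · exact absurd (Fin.le_last (w i)) (by rw [h]; exact hji.not_ge)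
      · exact absurd (Fin.le_last (w j)) (by rw [h]; exact hkj.not_ge)
    have hk : k = Fin.last m := by
      rcases hc with h | h | h
      · exact absurd (h.trans hi) hne
      · exact absurd (Fin.le_last k) (by rw [w.injective h]; exact hjk.not_ge)
      · exact (w.injective h).symm
    subst hk
    exact ⟨j, by rwa [← hi, Equiv.symm_apply_apply], hjk, hkj⟩
  · rintro ⟨j, h1, h2, h3⟩
    refine ⟨w.symm (Fin.last m), j, Fin.last m, h1, h2, h3, ?_, .inr (.inr rfl), .inl (by simp)⟩
    rw [Equiv.apply_symm_apply]
    refine lt_of_le_of_ne (Fin.le_last _) fun e => h1.ne' ?_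
    rw [← e, Equiv.symm_apply_apply]

lemma exists_last_larger {p : Fin (m + 1)}
    (h : ∃ j, p < j ∧ j < Fin.last m ∧ w (Fin.last m) < w j) :
    ∃ j, p < j ∧ j < Fin.last m ∧ w (Fin.last m) < w j ∧
      ∀ i, j < i → i < Fin.last m → w i < w (Fin.last m) := by
  classical
  obtain ⟨j₀, h₀⟩ := h
  obtain ⟨j, hj, hmax⟩ := Finset.exists_max_image
    (Finset.univ.filter fun j => p < j ∧ j < Fin.last m ∧ w (Fin.last m) < w j) id
    ⟨j₀, by simpa using h₀⟩
  simp only [Finset.mem_filter, Finset.mem_univ, true_and, id] at hj hmax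
  refine ⟨j, hj.1, hj.2.1, hj.2.2, fun i hi hil => ?_⟩
  by_contra hcon
  have hlt := lt_of_le_of_ne (not_lt.1 hcon) fun e => hil.ne' (w.injective e)
  exact (hmax i ⟨hj.1.trans hi, hil, hlt⟩).not_gt hi

/-- The largest value is always a right-to-left maximum. Any other one before the last position
exceeds `w(n)`, and the rightmost entry there exceeding `w(n)` is one. -/
lemma isFirstRLMaxAfterLast_iff (hne : w (Fin.last m) ≠ Fin.last m) :
    IsFirstRLMaxAfterLast w (Fin.last m) ↔
      ¬ ∃ j, w.symm (Fin.last m) < j ∧ j < Fin.last m ∧ w (Fin.last m) < w j := by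
  constructor
  · intro h hex
    obtain ⟨j, h1, h2, h3, h4⟩ := exists_last_larger hex
    refine (h.2 (show j ∈ _ from ⟨h2, fun i hi => ?_⟩)).not_gt h1
    rcases eq_or_lt_of_le (Fin.le_last i) with rfl | hil
    · exact h3
    · exact (h4 i hi hil).trans h3
  · refine fun h => ⟨⟨symm_last_lt hne, fun j hj => ?_⟩, fun i hi => ?_⟩
    · rw [Equiv.apply_symm_apply]
      refine lt_of_le_of_ne (Fin.le_last _) fun e => hj.ne' ?_
      rw [← e, Equiv.symm_apply_apply]
    · by_contra hcon
      exact h ⟨i, not_le.1 hcon, hi.1, hi.2 _ hi.1⟩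

end Patterns

theorem exists_forced_iff {m : ℕ} (hm : 1 ≤ m) {θ : Fin (m + 1) → ℝ} (hθ : IsDirectionSystem θ)
    {w : Equiv.Perm (Fin (m + 1))} (hw : FullySupported w) :
    (∃ t, IsForcedBottomPerimeterTile θ w t) ↔
      ¬ ∃ j, w.symm (Fin.last m) < j ∧ j < Fin.last m ∧ w (Fin.last m) < w j := by
  have hne := hw.last_ne hm
  constructor
  · rintro ⟨t, ht⟩ hex
    obtain ⟨j, h1, h2, h3, h4⟩ := exists_last_larger hex
    obtain ⟨T, hT, s, hs, s1, s2, s3⟩ := exists_isTilingOffLeft_bottom hθ (m - (j.val + 1)) w j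
      (by rw [Fin.lt_def, Fin.val_last] at h2; omega) h3 h4
    obtain ⟨htT, htb⟩ := ht T (hT.isRhombicTiling hm hθ hw)
    obtain ⟨t1, t2, t3⟩ := htb.labels_and_bottom hθ hne
    -- Both tiles have the bottom right side as lower right edge; its midpoint avoids the ends,
    -- where distinct tiles may meet.
    have hst : s = t := hT.eq_of_point_eq hθ hs htT (a := 1 / 2) (b := 1) (a' := 1 / 2) (b' := 1)
      (by norm_num) (by norm_num) (by norm_num) (by norm_num) (by
        have e := s3.trans t3.symm
        simp only [Tile.point, s1, t1] at e ⊢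
        push_cast at e ⊢
        linear_combination e)
    refine h1.ne' ?_
    rw [← t2, ← hst, s2, Equiv.symm_apply_apply]
  · intro h
    have hlt : w (Fin.last m) < Fin.last m := lt_of_le_of_ne (Fin.le_last _) hne
    have hfor : ∀ y, w (Fin.last m) < y → y < Fin.last m → w.symm y < w.symm (Fin.last m) :=
      fun y h1 h2 => by
        by_contra hcon
        refine h ⟨w.symm y, lt_of_le_of_ne (not_lt.1 hcon) fun e => h2.ne' (w.symm.injective e),
          lt_of_le_of_ne (Fin.le_last _) fun e => h1.ne ?_, by simpa using h1⟩
        rw [← e, Equiv.apply_symm_apply]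
    -- The top vertex is computed back from the bottom vertex, so labels and bottom vertex identify
    -- this tile in every tiling.
    refine ⟨⟨pathVertex θ 1 (m + 1) - dir θ (w (Fin.last m)) - dir θ (Fin.last m), _, _, hlt⟩,
      fun T hT => ⟨?_, isBottomPerimeterTile_of_labels rfl rfl (by simp only [Tile.point, Complex.ofReal_one]; ring)⟩⟩
    obtain ⟨t, ht, t1, t2, t3⟩ := hT.isTilingOffLeft.exists_bottom hθ T w hne hfor
    convert ht using 1
    refine Tile.eq_of_fields ?_ t1.symm t2.symm
    rw [← t3]
    simp only [Tile.point, t1, t2, Complex.ofReal_one]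
    ring

end Elnitsky

theorem corollary4 {m : ℕ} (hm : 1 ≤ m) (θ : Fin (m + 1) → ℝ) (hθ : Elnitsky.IsDirectionSystem θ)
    (w : Equiv.Perm (Fin (m + 1))) (hw : Elnitsky.FullySupported w) :
    ((∃ t, Elnitsky.IsForcedBottomPerimeterTile θ w t) ↔
      ¬ Elnitsky.TogetherIn321 w (w (Fin.last m)) (Fin.last m)) ∧
    ((∃ t, Elnitsky.IsForcedBottomPerimeterTile θ w t) ↔
      Elnitsky.IsFirstRLMaxAfterLast w (Fin.last m)) ∧
    (∀ t, Elnitsky.IsForcedBottomPerimeterTile θ w t →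
      t.labels = {Fin.last m, w (Fin.last m)}) := by
  have hne := hw.last_ne hm
  refine ⟨?_, ?_, fun t ht => ?_⟩
  · rw [Elnitsky.exists_forced_iff hm hθ hw, Elnitsky.togetherIn321_iff hne]
  · rw [Elnitsky.exists_forced_iff hm hθ hw, Elnitsky.isFirstRLMaxAfterLast_iff hne]
  -- Being forced is a statement about all tilings, so it yields information only once some tiling
  -- exists.
  · obtain ⟨T, hT⟩ := Elnitsky.exists_isTilingOffLeft hθ w
    obtain ⟨h1, h2, -⟩ :=
      ((ht T (hT.isRhombicTiling hm hθ hw)).2).labels_and_bottom hθ hne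
    rw [Elnitsky.Tile.labels, h1, h2, Finset.pair_comm]
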